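/- **Theorem 1.** Let $q(1),q(2),\dots$ be an irreducible (in particular: an ergodic) Markov chain on $\{1,\dots,Q\}$, $Q\ge 1$, with transition probabilities $p_{q,q'}$ and an arbitrary initial law $\rho$. In slot $t$ a scheduler chooses $s(t)\in\{0,1\}$; the age of information is $x(1)=1$, with $x(t+1)=1$ if $s(t)=1$ and $x(t+1)=x(t)+1$ if $s(t)=0$. A non-anticipative policy $\pi$ chooses $s(t)=1$ with a probability that may depend on all past and current ages and channel states and on the past decisions. Let $\omega(q)\ge 0$ be the power used by a transmission in channel state $q$, $\mathcal E>0$ the power budget and $W\ge 0$ a fixed multiplier. The decoupled power-constrained problem (CMDP) is to minimize, over the non-anticipative policies $\pi$, $$\limsup_{T\to\infty}\tfrac1T\,\mathbb E_\pi\Big[\sum_{t=1}^T \big(x(t)+W s(t)\big)\Big]\quad\text{subject to}\quad \limsup_{T\to\infty}\tfrac1T\,\mathbb E_\pi\Big[\sum_{t=1}^T s(t)\,\omega(q(t))\Big]\le\mathcal E .$$ For $X_{\max}\in\mathbb N$ let LP$(X_{\max})$ be the finite linear program in the variables $\mu_{x,q},y_{x,q}$, $1\le x\le X_{\max}$, $1\le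 q\le Q$: $$\begin{aligned}\min\ &\sum_{x=1}^{X_{\max}}\sum_{q=1}^{Q}\big(W y_{x,q}+x\,\mu_{x,q}\big)\\ \text{s.t. }&\mu_{1,q}=\sum_{x=1}^{X_{\max}}\sum_{q'=1}^{Q}y_{x,q'}\,p_{q',q},\qquad \mu_{x,q}=\sum_{q'=1}^{Q}(\mu_{x-1,q'}-y_{x-1,q'})\,p_{q',q}\quad(2\le x\le X_{\max}),\\ &\sum_{x,q}\mu_{x,q}=1,\qquad y_{x,q}\le\mu_{x,q},\qquad\sum_{x,q}y_{x,q}\,\omega(q)\le\mathcal E,\qquad 0\le\mu_{x,q}\le 1,\quad 0\le y_{x,q}\le 1 .\end{aligned}$$ (a) For every $X_{\max}$, $(\mu,y)$ is feasible for LP$(X_{\max})$ if and only if there are scheduling probabilities $\xi_{x,q}\in[0,1]$ with $\xi_{x,q}=1$ for all $x\ge X_{\max}$ such that $\mu$ is a steady-state distribution, on the states $(x,q)$ with $1\le x\le X_{\max}$, of the chain that moves from $(x,q)$ to $(1,q')$ with probability $\xi_{x,q}p_{q,q'}$ and to $(x+1,q')$ with probability $(1-\xi_{x,q})p_{q,q'}$,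 $y_{x,q}=\mu_{x,q}\xi_{x,q}$ for all $x,q$, and $\sum_{x,q}\mu_{x,q}\xi_{x,q}\omega(q)\le\mathcal E$. (b) There is $X_0$, depending only on $(p_{q,q'})$, $\omega$, $W$ and $\mathcal E$, such that for every $X_{\max}\ge X_0$ the program LP$(X_{\max})$ has an optimal solution, and for every initial law $\rho$: 1. the optimal value of the CMDP equals the optimal value of LP$(X_{\max})$; 2. for every optimal solution $(\mu,y)$ of LP$(X_{\max})$ there is an optimal policy of the CMDP under which, for all $1\le x\le X_{\max}$ and all $q$, the expected fraction of slots spent in state $(x,q)$ converges to $\mu_{x,q}$ and the expected fraction of slots spent in state $(x,q)$ and scheduled converges to $y_{x,q}$; its expected average cost converges to the LP objective $\sum_{x,q}(Wy_{x,q}+x\mu_{x,q})$, and its expected average power to $\sum_{x,q}y_{x,q}\omega(q)$; 3. conversely, if under an optimal policy of the CMDP these fractions converge to some $\mu_{x,q}$ and $y_{x,q}$ for all $1\le x\le X_{\max}$ and all $q$, then $(\mu,y)$ is an optimal solution of LP$(X_{\max})$; 4. if $\xi$ satisfies $\xi_{x,q}=1$ for all $x\ge X_{\max}$ and $\mu$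 is its only steady-state distribution, then the stationary randomized policy that schedules in state $(x,q)$ with probability $\xi_{x,q}$ is optimal for the CMDP if and only if $(\mu,y)$ with $y_{x,q}=\mu_{x,q}\xi_{x,q}$ is an optimal solution of LP$(X_{\max})$. -/

import Mathlib

open Filter Topology

namespace AoI

/-! ### The controlled process of one sensor

There are `Q` channel states. A *path* is the list of the pairs (channel state, decision) of the
slots that have passed, **most recent slot first**; the decision `true` means that the sensor is
scheduled. -/

/-- The age of information at the beginning of the slot that follows the path `h`: it is `1` in the
first slot, drops to `1` after a scheduled slot, and grows by one after an idle slot. -/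
def age {Q : ℕ} : List (Fin Q × Bool) → ℕ
  | [] => 1
  | (_, s) :: h => if s then 1 else age h + 1

/-- Non-anticipative (history dependent, randomized) policies: `π h q` is the probability that
the sensor is scheduled, given the path `h` so far and the current channel state `q`. -/
abbrev Policy (Q : ℕ) : Type := List (Fin Q × Bool) → Fin Q → unitInterval

/-- The stationary randomized policy that schedules in state `(x, q)` with probability `ξ x q`. -/
def stationary {Q : ℕ} (ξ : ℕ → Fin Q → unitInterval) : Policy Q :=
  fun h q => ξ (age h) q

/-- The conditional probability that the channel is in state `q` in the slot after the path `h`. The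
initial law is `ρ`, the transition matrix is `P` (`P i j` is the probability of `i → j`). -/
def channelProb {Q : ℕ} (P : Matrix (Fin Q) (Fin Q) ℝ) (ρ : Fin Q → ℝ) :
    List (Fin Q × Bool) → Fin Q → ℝ
  | [], q => ρ q
  | (q', _) :: _, q => P q' q

/-- The conditional probability of the decision `s`, given the path `h` and the channel state
`q`. -/
def decisionProb {Q : ℕ} (π : Policy Q) (h : List (Fin Q × Bool)) (q : Fin Q) (s : Bool) : ℝ :=
  if s then (π h q : ℝ) else 1 - (π h q : ℝ)

/-- The probability that the first slots of the process produce the given path. -/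
def pathProb {Q : ℕ} (P : Matrix (Fin Q) (Fin Q) ℝ) (ρ : Fin Q → ℝ) (π : Policy Q) :
    List (Fin Q × Bool) → ℝ
  | [] => 1
  | (q, s) :: h => pathProb P ρ π h * channelProb P ρ h q * decisionProb π h q s

/-- The sum of the one-step costs `c x q s` over the slots of a path. -/
def pathCost {Q : ℕ} (c : ℕ → Fin Q → Bool → ℝ) : List (Fin Q × Bool) → ℝ
  | [] => 0
  | (q, s) :: h => pathCost c h + c (age h) q s

/-- `(1 / T) 𝔼_π [∑ c(x(t), q(t), s(t))]`, the sum being over the first `T` slots; the expectation is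
the sum over all paths of length `T`. -/
noncomputable def expAvg {Q : ℕ} (P : Matrix (Fin Q) (Fin Q) ℝ) (ρ : Fin Q → ℝ) (π : Policy Q)
    (c : ℕ → Fin Q → Bool → ℝ) (T : ℕ) : ℝ :=
  (∑ v : Fin T → Fin Q × Bool,
    pathProb P ρ π (List.ofFn v) * pathCost c (List.ofFn v)) / (T : ℝ)

/-- The long-run expected average of the one-step cost `c` (upper limit, possibly `+∞`). -/
noncomputable def longRunAvg {Q : ℕ} (P : Matrix (Fin Q) (Fin Q) ℝ) (ρ : Fin Q → ℝ) (π : Policy Q)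
    (c : ℕ → Fin Q → Bool → ℝ) : EReal :=
  limsup (fun T : ℕ => ((expAvg P ρ π c T : ℝ) : EReal)) atTop

/-! ### The decoupled power-constrained problem -/

/-- One-step cost `x + W s`. -/
def costX {Q : ℕ} (W : ℝ) : ℕ → Fin Q → Bool → ℝ :=
  fun x _ s => (x : ℝ) + if s then W else 0

/-- One-step power consumption `ω(q) s`. -/
def costQ {Q : ℕ} (ω : Fin Q → ℝ) : ℕ → Fin Q → Bool → ℝ :=
  fun _ q s => if s then ω q else 0

/-- Indicator that the state is `(x, q)`. -/
def indState {Q : ℕ} (x : ℕ) (q : Fin Q) : ℕ → Fin Q → Bool → ℝ :=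
  fun x' q' _ => if x' = x ∧ q' = q then 1 else 0

/-- Indicator that the state is `(x, q)` and the sensor is scheduled. -/
def indSched {Q : ℕ} (x : ℕ) (q : Fin Q) : ℕ → Fin Q → Bool → ℝ :=
  fun x' q' s => if x' = x ∧ q' = q ∧ s = true then 1 else 0

/-- The average power constraint. -/
def IsFeasible {Q : ℕ} (P : Matrix (Fin Q) (Fin Q) ℝ) (ω : Fin Q → ℝ) (E : ℝ) (ρ : Fin Q → ℝ)
    (π : Policy Q) : Prop :=
  longRunAvg P ρ π (costQ ω) ≤ (E : EReal)

/-- The optimal value of the constrained Markov decision process over all non-anticipative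
policies. -/
noncomputable def cmdpValue {Q : ℕ} (P : Matrix (Fin Q) (Fin Q) ℝ) (ω : Fin Q → ℝ) (W E : ℝ)
    (ρ : Fin Q → ℝ) : EReal :=
  ⨅ (π : Policy Q) (_ : IsFeasible P ω E ρ π), longRunAvg P ρ π (costX W)

/-- `π` solves the constrained Markov decision process. -/
def IsOptimal {Q : ℕ} (P : Matrix (Fin Q) (Fin Q) ℝ) (ω : Fin Q → ℝ) (W E : ℝ) (ρ : Fin Q → ℝ)
    (π : Policy Q) : Prop :=
  IsFeasible P ω E ρ π ∧
    ∀ π' : Policy Q, IsFeasible P ω E ρ π' →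
      longRunAvg P ρ π (costX W) ≤ longRunAvg P ρ π' (costX W)

/-! ### Truncated stationary policies and their steady states

In the following the index `i : Fin X` stands for the age `x = i + 1 ∈ {1, …, X}`. -/

/-- The scheduling probabilities `ξ` schedule with certainty at all ages `x ≥ X`. -/
def IsTruncated {Q : ℕ} (X : ℕ) (ξ : ℕ → Fin Q → unitInterval) : Prop :=
  ∀ x, X ≤ x → ∀ q, ξ x q = 1

/-- Transition matrix of the state `(x, q)` under the scheduling probabilities `ξ`, on the ages
`1, …, X`: from `(x, q)` to `(1, q')` with probability `ξ x q * P q q'` and to `(x + 1, q')` with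
probability `(1 - ξ x q) * P q q'`. -/
def stateMatrix {Q : ℕ} (P : Matrix (Fin Q) (Fin Q) ℝ) (ξ : ℕ → Fin Q → unitInterval) (X : ℕ) :
    Matrix (Fin X × Fin Q) (Fin X × Fin Q) ℝ :=
  Matrix.of fun a b =>
    (if (b.1 : ℕ) = 0 then (ξ (a.1 + 1) a.2 : ℝ) * P a.2 b.2 else 0) +
      (if (b.1 : ℕ) = a.1 + 1 then (1 - (ξ (a.1 + 1) a.2 : ℝ)) * P a.2 b.2 else 0)

/-- `μ` is a steady-state distribution under the scheduling probabilities `ξ`. -/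
def IsSteadyState {Q : ℕ} (P : Matrix (Fin Q) (Fin Q) ℝ) (ξ : ℕ → Fin Q → unitInterval) (X : ℕ)
    (μ : Fin X → Fin Q → ℝ) : Prop :=
  Function.uncurry μ ∈ stdSimplex ℝ (Fin X × Fin Q) ∧
    Matrix.vecMul (Function.uncurry μ) (stateMatrix P ξ X) = Function.uncurry μ

/-- The variables `y_{x,q} = μ_{x,q} ξ_{x,q}`. -/
def schedOcc {Q X : ℕ} (μ : Fin X → Fin Q → ℝ) (ξ : ℕ → Fin Q → unitInterval) :
    Fin X → Fin Q → ℝ :=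
  fun i q => μ i q * (ξ (i + 1) q : ℝ)

/-! ### The linear program -/

/-- The constraints of the linear program. -/
structure IsLPFeasible {Q : ℕ} (P : Matrix (Fin Q) (Fin Q) ℝ) (ω : Fin Q → ℝ) (E : ℝ) (X : ℕ)
    (μ y : Fin X → Fin Q → ℝ) : Prop where
  balance_one : ∀ (i : Fin X) (q : Fin Q), (i : ℕ) = 0 →
    μ i q = ∑ j : Fin X, ∑ q' : Fin Q, y j q' * P q' q
  balance_succ : ∀ (i j : Fin X) (q : Fin Q), (j : ℕ) = i + 1 →
    μ j q = ∑ q' : Fin Q, (μ i q' - y i q') * P q' q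
  normalization : ∑ i : Fin X, ∑ q : Fin Q, μ i q = 1
  y_le_mu : ∀ i q, y i q ≤ μ i q
  power : ∑ i : Fin X, ∑ q : Fin Q, y i q * ω q ≤ E
  mu_mem : ∀ i q, 0 ≤ μ i q ∧ μ i q ≤ 1
  y_mem : ∀ i q, 0 ≤ y i q ∧ y i q ≤ 1

/-- The objective `∑ (W y_{x,q} + x μ_{x,q})` of the linear program. -/
def lpObjective {Q X : ℕ} (W : ℝ) (μ y : Fin X → Fin Q → ℝ) : ℝ :=
  ∑ i : Fin X, ∑ q : Fin Q, (W * y i q + ((i : ℝ) + 1) * μ i q)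

/-- `(μ, y)` solves the linear program. -/
def IsLPOptimal {Q : ℕ} (P : Matrix (Fin Q) (Fin Q) ℝ) (ω : Fin Q → ℝ) (W E : ℝ) (X : ℕ)
    (μ y : Fin X → Fin Q → ℝ) : Prop :=
  IsLPFeasible P ω E X μ y ∧
    ∀ μ' y' : Fin X → Fin Q → ℝ, IsLPFeasible P ω E X μ' y' →
      lpObjective W μ y ≤ lpObjective W μ' y'

/-- `(μ, y)` are the limiting occupation frequencies of the states `(x, q)`, and of the states
`(x, q)` jointly with being scheduled, for `x ∈ {1, …, X}`, under the policy `π`. -/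
def HasFrequencies {Q : ℕ} (P : Matrix (Fin Q) (Fin Q) ℝ) (ρ : Fin Q → ℝ) (π : Policy Q) {X : ℕ}
    (μ y : Fin X → Fin Q → ℝ) : Prop :=
  ∀ (i : Fin X) (q : Fin Q),
    Tendsto (expAvg P ρ π (indState (i + 1) q)) atTop (𝓝 (μ i q)) ∧
      Tendsto (expAvg P ρ π (indSched (i + 1) q)) atTop (𝓝 (y i q))

end AoI

/-! Both inequalities between the two optimal values are statements about long-run occupation
frequencies.

Lower bound (`exists_folded_limit`, `exists_lt_of_relaxed`). A feasible policy may reach arbitrarily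
large ages, so its ages are folded modulo `X` into `{1, …, X}`, and an idle slot at folded age `X`
is counted as a transmission. Frequencies of the folded process have subsequential limits that obey
the balance equations of the linear program. If `R` is the limit frequency of ages above `X`, the
fictitious transmissions add at most `(∑ q, ω q) * R` to the power and `W * R` to the objective,
whereas folding saves at least `X * R` of age. Hence the cost is at least the objective of a program
with relaxed budget, plus `(X - W) * R`. Mixing in a point of power at most `E / 2` repairs the
budget at a price proportional to `R`, with a factor independent of `X`. So for large `X` the
relaxation never pays, and an optimal policy must have `R = 0`. In that case folded and true
frequencies agree in the limit, which gives the converse direction.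

Upper bound (`IsLPFeasible.exists_policy`). A feasible `(μ, y)` is a steady state of `ξ = y / μ`,
but that chain may have several steady states and the initial law could select the wrong one. Mixing
`(μ, y)` with a vanishing share of the always-scheduling point gives chains with a unique steady
state, and a policy that switches through them slowly enough has exactly the frequencies `(μ, y)`
from every initial law. The ergodic theorem behind this (`exists_tendsto_expAvg`) telescopes
solutions of the Poisson equation; as only averages over time are involved, periodicity is harmless.
-/

namespace AoI

/-! ### Expectations over paths, and global balance for long-run averages. -/

section PathExpectation

variable {Q : ℕ} (P : Matrix (Fin Q) (Fin Q) ℝ) (ρ : Fin Q → ℝ) (π : Policy Q)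

/-- The expectation of a function of the path formed by the first `T` slots. -/
noncomputable def pathExp (T : ℕ) (f : List (Fin Q × Bool) → ℝ) : ℝ :=
  ∑ v : Fin T → Fin Q × Bool, pathProb P ρ π (List.ofFn v) * f (List.ofFn v)

/-- The conditional expectation, given the path `h`, of the cost of the next slot. -/
noncomputable def condCost (c : ℕ → Fin Q → Bool → ℝ) (h : List (Fin Q × Bool)) : ℝ :=
  ∑ q, channelProb P ρ h q * ∑ s, decisionProb π h q s * c (age h) q s

/-- The conditional expectation, given the path `h`, of a function of the next state. -/
noncomputable def condState (g : ℕ → Fin Q → ℝ) (h : List (Fin Q × Bool)) : ℝ :=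
  ∑ q, channelProb P ρ h q * g (age h) q

/-- The expectation of `g` at the successor of the state `(x, q)` under the decision `s`. -/
noncomputable def nextCost (g : ℕ → Fin Q → ℝ) (x : ℕ) (q : Fin Q) (s : Bool) : ℝ :=
  ∑ q', P q q' * g (if s then 1 else x + 1) q'

variable {P ρ π}

lemma one_le_age (h : List (Fin Q × Bool)) : 1 ≤ age h := by
  induction h with
  | nil => simp [age]
  | cons a h ih =>
    obtain ⟨q, s⟩ := a
    cases s <;> simp [age]

lemma sum_decisionProb (h : List (Fin Q × Bool)) (q : Fin Q) :
    ∑ s, decisionProb π h q s = 1 := by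
  simp [decisionProb]

lemma decisionProb_nonneg (h : List (Fin Q × Bool)) (q : Fin Q) (s : Bool) :
    0 ≤ decisionProb π h q s := by
  have h0 := (π h q).2.1
  have h1 := (π h q).2.2
  cases s <;> simp [decisionProb] <;> linarith

lemma sum_channelProb (hP : P ∈ Matrix.rowStochastic ℝ (Fin Q)) (hρ : ρ ∈ stdSimplex ℝ (Fin Q))
    (h : List (Fin Q × Bool)) : ∑ q, channelProb P ρ h q = 1 := by
  cases h with
  | nil => simpa [channelProb] using hρ.2
  | cons a h => simpa [channelProb] using Matrix.sum_row_of_mem_rowStochastic hP a.1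

lemma channelProb_nonneg (hP : P ∈ Matrix.rowStochastic ℝ (Fin Q))
    (hρ : ρ ∈ stdSimplex ℝ (Fin Q)) (h : List (Fin Q × Bool)) (q : Fin Q) :
    0 ≤ channelProb P ρ h q := by
  cases h with
  | nil => simpa [channelProb] using hρ.1 q
  | cons a h => simpa [channelProb] using Matrix.nonneg_of_mem_rowStochastic hP

lemma pathProb_nonneg (hP : P ∈ Matrix.rowStochastic ℝ (Fin Q))
    (hρ : ρ ∈ stdSimplex ℝ (Fin Q)) (h : List (Fin Q × Bool)) : 0 ≤ pathProb P ρ π h := by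
  induction h with
  | nil => simp [pathProb]
  | cons a h ih =>
    exact mul_nonneg (mul_nonneg ih (channelProb_nonneg hP hρ h _)) (decisionProb_nonneg h _ _)

lemma pathExp_zero (f : List (Fin Q × Bool) → ℝ) : pathExp P ρ π 0 f = f [] := by
  simp [pathExp, pathProb]

/-- The most recent slot is the head of the list, so conditioning on the first `T` slots is
splitting off the head of the tuple. -/
lemma pathExp_succ (T : ℕ) (f : List (Fin Q × Bool) → ℝ) :
    pathExp P ρ π (T + 1) f = pathExp P ρ π T (fun h =>
      ∑ q, channelProb P ρ h q * ∑ s, decisionProb π h q s * f ((q, s) :: h)) := by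
  unfold pathExp
  rw [← (Fin.consEquiv (fun _ : Fin (T + 1) => Fin Q × Bool)).sum_comp, Fintype.sum_prod_type,
    Finset.sum_comm]
  refine Finset.sum_congr rfl fun v _ => ?_
  rw [Fintype.sum_prod_type, Finset.mul_sum]
  refine Finset.sum_congr rfl fun q _ => ?_
  rw [Finset.mul_sum, Finset.mul_sum]
  refine Finset.sum_congr rfl fun s _ => ?_
  simp only [Fin.consEquiv_apply, List.ofFn_succ, Fin.cons_zero, Fin.cons_succ, pathProb]
  ring

lemma pathExp_add (T : ℕ) (f g : List (Fin Q × Bool) → ℝ) :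
    pathExp P ρ π T (fun h => f h + g h) = pathExp P ρ π T f + pathExp P ρ π T g := by
  simp [pathExp, mul_add, Finset.sum_add_distrib]

lemma pathExp_const_mul (T : ℕ) (a : ℝ) (f : List (Fin Q × Bool) → ℝ) :
    pathExp P ρ π T (fun h => a * f h) = a * pathExp P ρ π T f := by
  simp only [pathExp, Finset.mul_sum]
  exact Finset.sum_congr rfl fun v _ => by ring

lemma pathExp_sub (T : ℕ) (f g : List (Fin Q × Bool) → ℝ) :
    pathExp P ρ π T (fun h => f h - g h) = pathExp P ρ π T f - pathExp P ρ π T g := by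
  simp [pathExp, mul_sub, Finset.sum_sub_distrib]

lemma pathExp_const (hP : P ∈ Matrix.rowStochastic ℝ (Fin Q)) (hρ : ρ ∈ stdSimplex ℝ (Fin Q))
    (T : ℕ) (a : ℝ) : pathExp P ρ π T (fun _ => a) = a := by
  induction T with
  | zero => rw [pathExp_zero]
  | succ T ih =>
    rw [pathExp_succ]
    simp_rw [← Finset.sum_mul, sum_decisionProb, one_mul, ← Finset.sum_mul,
      sum_channelProb hP hρ, one_mul]
    exact ih

/-- Allows identities that hold only on the paths a policy can produce, such as those with age at
most `X`. -/
lemma pathExp_congr_of_pathProb {T : ℕ} {f g : List (Fin Q × Bool) → ℝ}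
    (hfg : ∀ h, h.length = T → pathProb P ρ π h ≠ 0 → f h = g h) :
    pathExp P ρ π T f = pathExp P ρ π T g := by
  refine Finset.sum_congr rfl fun v _ => ?_
  by_cases hv : pathProb P ρ π (List.ofFn v) = 0
  · simp [hv]
  · rw [hfg _ (by simp) hv]

lemma pathExp_mono (hP : P ∈ Matrix.rowStochastic ℝ (Fin Q)) (hρ : ρ ∈ stdSimplex ℝ (Fin Q))
    {T : ℕ} {f g : List (Fin Q × Bool) → ℝ} (hfg : ∀ h, f h ≤ g h) :
    pathExp P ρ π T f ≤ pathExp P ρ π T g :=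
  Finset.sum_le_sum fun _ _ => mul_le_mul_of_nonneg_left (hfg _) (pathProb_nonneg hP hρ _)

lemma abs_pathExp_le (hP : P ∈ Matrix.rowStochastic ℝ (Fin Q)) (hρ : ρ ∈ stdSimplex ℝ (Fin Q))
    {T : ℕ} {f : List (Fin Q × Bool) → ℝ} {M : ℝ} (hf : ∀ h, |f h| ≤ M) :
    |pathExp P ρ π T f| ≤ M := by
  rw [abs_le]
  constructor
  · rw [← pathExp_const (π := π) hP hρ T (-M)]
    exact pathExp_mono hP hρ fun h => (abs_le.1 (hf h)).1
  · rw [← pathExp_const (π := π) hP hρ T M]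
    exact pathExp_mono hP hρ fun h => (abs_le.1 (hf h)).2

lemma abs_condState_le (hP : P ∈ Matrix.rowStochastic ℝ (Fin Q))
    (hρ : ρ ∈ stdSimplex ℝ (Fin Q)) {g : ℕ → Fin Q → ℝ} {M : ℝ} (hg : ∀ x q, |g x q| ≤ M)
    (h : List (Fin Q × Bool)) : |condState P ρ g h| ≤ M := by
  calc |condState P ρ g h| ≤ ∑ q, |channelProb P ρ h q * g (age h) q| :=
        Finset.abs_sum_le_sum_abs _ _
    _ ≤ ∑ q, channelProb P ρ h q * M := by
        refine Finset.sum_le_sum fun q _ => ?_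
        rw [abs_mul, abs_of_nonneg (channelProb_nonneg hP hρ h q)]
        exact mul_le_mul_of_nonneg_left (hg _ _) (channelProb_nonneg hP hρ h q)
    _ = M := by rw [← Finset.sum_mul, sum_channelProb hP hρ, one_mul]

lemma condCost_state (g : ℕ → Fin Q → ℝ) (h : List (Fin Q × Bool)) :
    condCost P ρ π (fun x q _ => g x q) h = condState P ρ g h := by
  simp only [condCost, condState, ← Finset.sum_mul, sum_decisionProb, one_mul]

lemma pathExp_succ_condState (T : ℕ) (g : ℕ → Fin Q → ℝ) :
    pathExp P ρ π (T + 1) (condState P ρ g) =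
      pathExp P ρ π T (condCost P ρ π (nextCost P g)) := by
  rw [pathExp_succ]
  rfl

lemma pathExp_succ_pathCost (hP : P ∈ Matrix.rowStochastic ℝ (Fin Q))
    (hρ : ρ ∈ stdSimplex ℝ (Fin Q)) (c : ℕ → Fin Q → Bool → ℝ) (T : ℕ) :
    pathExp P ρ π (T + 1) (pathCost c) =
      pathExp P ρ π T (pathCost c) + pathExp P ρ π T (condCost P ρ π c) := by
  rw [pathExp_succ, ← pathExp_add]
  congr 1
  funext h
  simp only [pathCost, mul_add, Finset.sum_add_distrib, ← Finset.sum_mul, sum_decisionProb,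
    one_mul, sum_channelProb hP hρ, condCost]

lemma pathExp_pathCost (hP : P ∈ Matrix.rowStochastic ℝ (Fin Q))
    (hρ : ρ ∈ stdSimplex ℝ (Fin Q)) (c : ℕ → Fin Q → Bool → ℝ) (T : ℕ) :
    pathExp P ρ π T (pathCost c) =
      ∑ t ∈ Finset.range T, pathExp P ρ π t (condCost P ρ π c) := by
  induction T with
  | zero => simp [pathExp_zero, pathCost]
  | succ T ih => rw [pathExp_succ_pathCost hP hρ, ih, Finset.sum_range_succ]

lemma expAvg_eq (c : ℕ → Fin Q → Bool → ℝ) (T : ℕ) :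
    expAvg P ρ π c T = pathExp P ρ π T (pathCost c) / T := rfl

lemma pathCost_add (c d : ℕ → Fin Q → Bool → ℝ) (h : List (Fin Q × Bool)) :
    pathCost (fun x q s => c x q s + d x q s) h = pathCost c h + pathCost d h := by
  induction h with
  | nil => simp [pathCost]
  | cons a h ih => simp only [pathCost, ih]; ring

lemma pathCost_const_mul (a : ℝ) (c : ℕ → Fin Q → Bool → ℝ) (h : List (Fin Q × Bool)) :
    pathCost (fun x q s => a * c x q s) h = a * pathCost c h := by
  induction h with
  | nil => simp [pathCost]
  | cons a h ih => simp only [pathCost, ih]; ring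

/-- Ages start at `1`, so costs need comparing only there; this keeps the truncated subtraction `x -
1` of the folding harmless. -/
lemma pathCost_mono {c d : ℕ → Fin Q → Bool → ℝ} (hcd : ∀ x q s, 1 ≤ x → c x q s ≤ d x q s)
    (h : List (Fin Q × Bool)) : pathCost c h ≤ pathCost d h := by
  induction h with
  | nil => simp [pathCost]
  | cons a h ih => exact add_le_add ih (hcd _ _ _ (one_le_age h))

lemma expAvg_add (c d : ℕ → Fin Q → Bool → ℝ) (T : ℕ) :
    expAvg P ρ π (fun x q s => c x q s + d x q s) T = expAvg P ρ π c T + expAvg P ρ π d T := by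
  simp only [expAvg_eq, ← add_div, ← pathExp_add, ← pathCost_add]

lemma expAvg_const_mul (a : ℝ) (c : ℕ → Fin Q → Bool → ℝ) (T : ℕ) :
    expAvg P ρ π (fun x q s => a * c x q s) T = a * expAvg P ρ π c T := by
  simp only [expAvg_eq, mul_div_assoc', ← pathExp_const_mul, ← pathCost_const_mul]

lemma expAvg_sub (c d : ℕ → Fin Q → Bool → ℝ) (T : ℕ) :
    expAvg P ρ π (fun x q s => c x q s - d x q s) T = expAvg P ρ π c T - expAvg P ρ π d T := by
  have h := expAvg_add (P := P) (ρ := ρ) (π := π) c (fun x q s => (-1) * d x q s) T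
  rw [expAvg_const_mul] at h
  simpa [sub_eq_add_neg] using h

lemma expAvg_zero_cost (T : ℕ) : expAvg P ρ π (fun _ _ _ => 0) T = 0 := by
  simpa using expAvg_const_mul (P := P) (ρ := ρ) (π := π) 0 (fun _ _ _ => 0) T

lemma expAvg_sum {ι : Type*} (I : Finset ι) (c : ι → ℕ → Fin Q → Bool → ℝ) (T : ℕ) :
    expAvg P ρ π (fun x q s => ∑ i ∈ I, c i x q s) T = ∑ i ∈ I, expAvg P ρ π (c i) T := by
  classical
  induction I using Finset.induction_on with
  | empty => simpa using expAvg_zero_cost T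
  | insert i I hi ih => simp only [Finset.sum_insert hi, expAvg_add, ih]

lemma expAvg_mono (hP : P ∈ Matrix.rowStochastic ℝ (Fin Q)) (hρ : ρ ∈ stdSimplex ℝ (Fin Q))
    {c d : ℕ → Fin Q → Bool → ℝ} (hcd : ∀ x q s, 1 ≤ x → c x q s ≤ d x q s) (T : ℕ) :
    expAvg P ρ π c T ≤ expAvg P ρ π d T :=
  div_le_div_of_nonneg_right (pathExp_mono hP hρ (pathCost_mono hcd)) (Nat.cast_nonneg T)

lemma expAvg_congr (hP : P ∈ Matrix.rowStochastic ℝ (Fin Q)) (hρ : ρ ∈ stdSimplex ℝ (Fin Q))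
    {c d : ℕ → Fin Q → Bool → ℝ} (hcd : ∀ x q s, 1 ≤ x → c x q s = d x q s) (T : ℕ) :
    expAvg P ρ π c T = expAvg P ρ π d T :=
  le_antisymm (expAvg_mono hP hρ (fun x q s hx => (hcd x q s hx).le) T)
    (expAvg_mono hP hρ (fun x q s hx => (hcd x q s hx).ge) T)

lemma pathCost_one (h : List (Fin Q × Bool)) :
    pathCost (fun _ _ _ => (1 : ℝ)) h = h.length := by
  induction h with
  | nil => simp [pathCost]
  | cons a h ih => simp [pathCost, ih]

lemma expAvg_one (hP : P ∈ Matrix.rowStochastic ℝ (Fin Q)) (hρ : ρ ∈ stdSimplex ℝ (Fin Q))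
    {T : ℕ} (hT : T ≠ 0) : expAvg P ρ π (fun _ _ _ => 1) T = 1 := by
  rw [expAvg_eq, pathExp_congr_of_pathProb (g := fun _ => (T : ℝ)), pathExp_const hP hρ, div_self]
  · exact_mod_cast hT
  · intro h hh _
    rw [pathCost_one, hh]

lemma expAvg_mem_Icc (hP : P ∈ Matrix.rowStochastic ℝ (Fin Q)) (hρ : ρ ∈ stdSimplex ℝ (Fin Q))
    {c : ℕ → Fin Q → Bool → ℝ} (h0 : ∀ x q s, 0 ≤ c x q s) (h1 : ∀ x q s, c x q s ≤ 1) (T : ℕ) :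
    0 ≤ expAvg P ρ π c T ∧ expAvg P ρ π c T ≤ 1 := by
  constructor
  · rw [← expAvg_zero_cost (P := P) (ρ := ρ) (π := π) T]
    exact expAvg_mono hP hρ (fun x q s _ => h0 x q s) T
  · rcases eq_or_ne T 0 with rfl | hT
    · simp [expAvg_eq]
    · rw [← expAvg_one (P := P) (ρ := ρ) (π := π) hP hρ hT]
      exact expAvg_mono hP hρ (fun x q s _ => h1 x q s) T

/-- Global balance: in the long run, a bounded function of the state has the same average as
its one-step prediction. -/
lemma tendsto_expAvg_nextCost_sub (hP : P ∈ Matrix.rowStochastic ℝ (Fin Q))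
    (hρ : ρ ∈ stdSimplex ℝ (Fin Q)) {g : ℕ → Fin Q → ℝ} {M : ℝ} (hg : ∀ x q, |g x q| ≤ M) :
    Tendsto (fun T => expAvg P ρ π (nextCost P g) T - expAvg P ρ π (fun x q _ => g x q) T)
      atTop (𝓝 0) := by
  -- The prediction made in slot `t` has the same mean as the function in slot `t + 1`, so the
  -- difference of the two sums telescopes to boundary terms.
  have key : ∀ T, pathExp P ρ π T (pathCost (nextCost P g)) -
      pathExp P ρ π T (pathCost fun x q _ => g x q) =
      pathExp P ρ π T (condState P ρ g) - pathExp P ρ π 0 (condState P ρ g) := by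
    intro T
    rw [pathExp_pathCost hP hρ, pathExp_pathCost hP hρ, ← Finset.sum_sub_distrib,
      ← Finset.sum_range_sub (fun t => pathExp P ρ π t (condState P ρ g))]
    refine Finset.sum_congr rfl fun t _ => ?_
    rw [pathExp_succ_condState]
    congr 2
    funext h
    exact condCost_state g h
  refine squeeze_zero_norm (a := fun T : ℕ => (2 * M) / (T : ℝ)) (fun T => ?_)
    (tendsto_const_div_atTop_nhds_zero_nat _)
  rw [expAvg_eq, expAvg_eq, ← sub_div, key, Real.norm_eq_abs, abs_div, Nat.abs_cast]
  refine div_le_div_of_nonneg_right ?_ (Nat.cast_nonneg T)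
  have h1 := abs_pathExp_le (π := π) (T := T) hP hρ (abs_condState_le hP hρ hg)
  have h2 := abs_pathExp_le (π := π) (T := 0) hP hρ (abs_condState_le hP hρ hg)
  calc _ ≤ _ := abs_sub _ _
    _ ≤ 2 * M := by linarith

end PathExpectation

end AoI

namespace AoI

/-! ### Folding the age modulo `X`. -/

section Folding

variable {Q : ℕ} {P : Matrix (Fin Q) (Fin Q) ℝ} {ρ : Fin Q → ℝ} {π : Policy Q} {X : ℕ}

/-- Indicator that the age, folded modulo `X` into `{1, …, X}`, is `i + 1` and the channel state
is `q`. -/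
def foldState {Q : ℕ} (X i : ℕ) (q : Fin Q) : ℕ → Fin Q → Bool → ℝ :=
  fun x q' _ => if (x - 1) % X = i ∧ q' = q then 1 else 0

/-- Indicator that the folded state is `(i + 1, q)` and that the sensor is scheduled or the folded
age is maximal. -/
def foldSched {Q : ℕ} (X i : ℕ) (q : Fin Q) : ℕ → Fin Q → Bool → ℝ :=
  fun x q' s => if (x - 1) % X = i ∧ q' = q ∧ (s = true ∨ i + 1 = X) then 1 else 0

/-- Indicator that the age exceeds `X`. -/
def overAge {Q : ℕ} (X : ℕ) : ℕ → Fin Q → ℝ := fun x _ => if X < x then 1 else 0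

/-- Indicator that the age exceeds `X` in the next slot. -/
def overNext {Q : ℕ} (X : ℕ) : ℕ → Fin Q → Bool → ℝ :=
  fun x _ s => if s = false ∧ X ≤ x then 1 else 0

/-- With global balance, this gives `overAge` and `overNext` the same limit frequency. -/
lemma nextCost_overAge (hP : P ∈ Matrix.rowStochastic ℝ (Fin Q)) (hX : 1 ≤ X) (x : ℕ)
    (q : Fin Q) (s : Bool) : nextCost P (overAge X) x q s = overNext X x q s := by
  cases s
  · simp [nextCost, overAge, overNext, Matrix.sum_row_of_mem_rowStochastic hP]
  · simp [nextCost, overAge, overNext, Nat.not_lt.2 hX]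

lemma foldSched_sum (hX : 1 ≤ X) (c : ℕ → Fin Q → ℝ) (x : ℕ) (q : Fin Q) (s : Bool) :
    ∑ i : Fin X, ∑ q', foldSched X i q' x q s * c i q' =
      if s = true ∨ (x - 1) % X + 1 = X then c ((x - 1) % X) q else 0 := by
  have hlt : (x - 1) % X < X := Nat.mod_lt _ hX
  rw [Finset.sum_eq_single (⟨(x - 1) % X, hlt⟩ : Fin X), Finset.sum_eq_single q]
  · simp [foldSched]
  · intro q' _ hq
    simp [foldSched, Ne.symm hq]
  · simp
  · intro i _ hi
    refine Finset.sum_eq_zero fun q' _ => ?_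
    have : (x - 1) % X ≠ i := fun h => hi (Fin.ext h.symm)
    simp [foldSched, this]
  · simp

lemma foldState_sum (hX : 1 ≤ X) (c : ℕ → Fin Q → ℝ) (x : ℕ) (q : Fin Q) (s : Bool) :
    ∑ i : Fin X, ∑ q', foldState X i q' x q s * c i q' = c ((x - 1) % X) q := by
  have hlt : (x - 1) % X < X := Nat.mod_lt _ hX
  rw [Finset.sum_eq_single (⟨(x - 1) % X, hlt⟩ : Fin X), Finset.sum_eq_single q]
  · simp [foldState]
  · intro q' _ hq
    simp [foldState, Ne.symm hq]
  · simp
  · intro i _ hi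
    refine Finset.sum_eq_zero fun q' _ => ?_
    have : (x - 1) % X ≠ i := fun h => hi (Fin.ext h.symm)
    simp [foldState, this]
  · simp

lemma nextCost_foldState (i : ℕ) (q : Fin Q) (x : ℕ) (q' : Fin Q) (s : Bool) :
    nextCost P (fun x q' => foldState X i q x q' true) x q' s =
      if ((if s = true then 1 else x + 1) - 1) % X = i then P q' q else 0 := by
  rw [nextCost, Finset.sum_eq_single q]
  · simp [foldState]
  · intro q'' _ h
    simp [foldState, h]
  · simp

/-- The left side is the folded index of age `x + 1`: an idle slot advances the folded age by one,
or wraps it from `X` to `1`. -/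
lemma mod_pred_succ (hX : 1 ≤ X) {x : ℕ} (hx : 1 ≤ x) :
    x % X = if (x - 1) % X + 1 = X then 0 else (x - 1) % X + 1 := by
  obtain ⟨y, rfl⟩ : ∃ y, x = y + 1 := ⟨x - 1, by omega⟩
  simp only [Nat.add_sub_cancel]
  rw [Nat.add_mod]
  have hlt : y % X < X := Nat.mod_lt _ hX
  rcases eq_or_ne X 1 with rfl | h1
  · simp [Nat.mod_one]
  · rw [Nat.mod_eq_of_lt (show 1 < X by omega)]
    split_ifs with h
    · rw [h, Nat.mod_self]
    · exact Nat.mod_eq_of_lt (by omega)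

/-- Folded age `1` is entered after a transmission or by wrapping around, exactly the slots that
`foldSched` counts. Averaged, this becomes the first balance equation of the program;
`nextCost_foldState_succ` yields the second. -/
lemma nextCost_foldState_zero (hX : 1 ≤ X) (q : Fin Q) {x : ℕ} (hx : 1 ≤ x) (q' : Fin Q)
    (s : Bool) :
    nextCost P (fun x q' => foldState X 0 q x q' true) x q' s =
      ∑ j : Fin X, ∑ q'', P q'' q * foldSched X j q'' x q' s := by
  simp only [mul_comm (P _ q)]
  rw [nextCost_foldState, foldSched_sum hX (fun _ q'' => P q'' q)]
  have := mod_pred_succ hX hx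
  cases s
  · simp only [Bool.false_eq_true, if_false, Nat.add_sub_cancel, false_or]
    split_ifs at * <;> first | rfl | omega
  · simp

lemma nextCost_foldState_succ (hX : 1 ≤ X) {i : ℕ} (hi : i + 1 < X) (q : Fin Q) {x : ℕ}
    (hx : 1 ≤ x) (q' : Fin Q) (s : Bool) :
    nextCost P (fun x q' => foldState X (i + 1) q x q' true) x q' s =
      ∑ q'', P q'' q * (foldState X i q'' x q' s - foldSched X i q'' x q' s) := by
  rw [nextCost_foldState, Finset.sum_eq_single q']
  · have := mod_pred_succ hX hx
    have hi' : i + 1 ≠ X := hi.ne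
    cases s
    · simp only [Bool.false_eq_true, if_false, Nat.add_sub_cancel, foldState, foldSched, hi',
        or_false, and_false, and_true]
      split_ifs at * <;> first | (exfalso; omega) | simp
    · simp [foldState, foldSched]
  · intro q'' _ h
    simp [foldState, foldSched, Ne.symm h]
  · simp

lemma sub_one_mod_le_of_lt (hX : 1 ≤ X) {x : ℕ} (hx : X < x) : (x - 1) % X + 1 + X ≤ x := by
  have h1 := Nat.mod_add_div (x - 1) X
  have h2 : 1 ≤ (x - 1) / X := (Nat.one_le_div_iff hX).2 (by omega)
  have h3 : X * 1 ≤ X * ((x - 1) / X) := Nat.mul_le_mul_left X h2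
  omega

/-- An age above `X` drops by at least `X` under folding. A fictitious transmission occurs only in
an idle slot of age at least `X`, so `W * overNext` covers its charge. -/
lemma fold_costX_le (hX : 1 ≤ X) {W : ℝ} (hW : 0 ≤ W) {x : ℕ} (hx : 1 ≤ x) (q : Fin Q)
    (s : Bool) :
    ∑ i : Fin X, ∑ q', (W * foldSched X i q' x q s + ((i : ℝ) + 1) * foldState X i q' x q s) +
      X * overAge X x q - W * overNext X x q s ≤ costX W x q s := by
  have h1 : ∑ i : Fin X, ∑ q', (W * foldSched X i q' x q s +
      ((i : ℝ) + 1) * foldState X i q' x q s) =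
      (if s = true ∨ (x - 1) % X + 1 = X then W else 0) + (((x - 1) % X : ℕ) + 1 : ℝ) := by
    rw [← foldSched_sum hX (fun _ _ => W), ← foldState_sum hX (fun i _ => (i : ℝ) + 1) x q s,
      ← Finset.sum_add_distrib]
    refine Finset.sum_congr rfl fun i _ => ?_
    rw [← Finset.sum_add_distrib]
    exact Finset.sum_congr rfl fun q' _ => by ring
  rw [h1]
  have h2 : (((x - 1) % X : ℕ) + 1 : ℝ) + X * overAge X x q ≤ x := by
    unfold overAge
    split_ifs with h
    · have := sub_one_mod_le_of_lt hX h
      rw [mul_one]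
      exact_mod_cast this
    · rw [mul_zero, add_zero]
      have := Nat.mod_le (x - 1) X
      exact_mod_cast (by omega : (x - 1) % X + 1 ≤ x)
  have h3 : (if s = true ∨ (x - 1) % X + 1 = X then W else 0) - W * overNext X x q s ≤
      if s then W else 0 := by
    cases s
    · have : (x - 1) % X + 1 = X → X ≤ x := fun h => by
        have := Nat.mod_le (x - 1) X
        omega
      by_cases h : (x - 1) % X + 1 = X
      · simp [overNext, h, this h]
      · simp only [overNext, h]
        split_ifs <;> simp_all
    · simp [overNext]
  unfold costX
  linarith

lemma fold_costQ_le (hX : 1 ≤ X) {ω : Fin Q → ℝ} (hω : ∀ q, 0 ≤ ω q) {x : ℕ} (hx : 1 ≤ x)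
    (q : Fin Q) (s : Bool) :
    ∑ i : Fin X, ∑ q', ω q' * foldSched X i q' x q s ≤
      costQ ω x q s + (∑ q', ω q') * overNext X x q s := by
  simp only [mul_comm (ω _)]
  rw [foldSched_sum hX (fun _ q' => ω q')]
  have hle : ω q ≤ ∑ q', ω q' := Finset.single_le_sum (fun q' _ => hω q') (Finset.mem_univ q)
  cases s
  · have h' : (x - 1) % X + 1 = X → X ≤ x := fun h => by
      have := Nat.mod_le (x - 1) X
      omega
    by_cases h : (x - 1) % X + 1 = X
    · simpa [overNext, h, h' h, costQ] using hle
    · simp only [h, costQ, overNext]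
      have := Finset.sum_nonneg fun q' (_ : q' ∈ Finset.univ) => hω q'
      split_ifs <;> simp_all
  · simp [costQ, overNext]

lemma mod_eq_iff_of_le {x : ℕ} (hx : 1 ≤ x) (hxX : x ≤ X) (i : ℕ) :
    (x - 1) % X = i ↔ x = i + 1 := by
  rw [Nat.mod_eq_of_lt (by omega)]
  omega

/-- This and the next three lemmas sandwich the folded frequencies: they differ from the true ones
by at most the frequencies of `overAge` and `overNext`. -/
lemma foldState_sub_le (i : ℕ) (q : Fin Q) {x : ℕ} (hx : 1 ≤ x) (q' : Fin Q) (s : Bool) :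
    foldState X i q x q' s ≤ indState (i + 1) q x q' s + overAge X x q' := by
  by_cases hxX : x ≤ X
  · simp [foldState, indState, overAge, mod_eq_iff_of_le hx hxX, Nat.not_lt.2 hxX]
  · simp only [foldState, indState, overAge, Nat.lt_of_not_le hxX, if_true]
    split_ifs <;> norm_num

lemma indState_le_foldState {i : ℕ} (hi : i < X) (q : Fin Q) (x : ℕ) (q' : Fin Q) (s : Bool) :
    indState (i + 1) q x q' s ≤ foldState X i q x q' s := by
  unfold indState foldState
  split_ifs with h1 h2 h2
  · exact le_rfl
  · exact absurd ⟨by rw [h1.1, Nat.add_sub_cancel, Nat.mod_eq_of_lt hi], h1.2⟩ h2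
  · exact zero_le_one
  · exact le_rfl

lemma foldSched_sub_le (i : ℕ) (q : Fin Q) {x : ℕ} (hx : 1 ≤ x) (q' : Fin Q) (s : Bool) :
    foldSched X i q x q' s ≤ indSched (i + 1) q x q' s + overAge X x q' + overNext X x q' s := by
  by_cases hxX : x ≤ X
  · simp only [foldSched, indSched, overAge, overNext, mod_eq_iff_of_le hx hxX,
      Nat.not_lt.2 hxX, if_false]
    cases s
    · by_cases h : x = i + 1 ∧ q' = q ∧ i + 1 = X
      · simp [h.1, h.2.1, h.2.2]
      · simp only [Bool.false_eq_true, false_or, h, and_false, if_false, true_and]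
        split_ifs <;> norm_num
    · simp
  · simp only [foldSched, indSched, overAge, overNext, Nat.lt_of_not_le hxX, if_true]
    split_ifs <;> norm_num

lemma indSched_le_foldSched {i : ℕ} (hi : i < X) (q : Fin Q) (x : ℕ) (q' : Fin Q) (s : Bool) :
    indSched (i + 1) q x q' s ≤ foldSched X i q x q' s := by
  unfold indSched foldSched
  split_ifs with h1 h2 h2
  · exact le_rfl
  · exact absurd ⟨by rw [h1.1, Nat.add_sub_cancel, Nat.mod_eq_of_lt hi], h1.2.1, .inl h1.2.2⟩ h2
  · exact zero_le_one
  · exact le_rfl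

end Folding

end AoI

namespace AoI

/-! ### Every feasible policy costs at least a relaxed linear program. -/

section LowerBound

variable {Q : ℕ} {P : Matrix (Fin Q) (Fin Q) ℝ} {ρ : Fin Q → ℝ} {π : Policy Q} {X : ℕ}

/-- Since the criteria are upper limits, bounds along one subsequence suffice. Working in `EReal`
covers policies of infinite cost. -/
lemma le_limsup_of_tendsto_subseq {u l : ℕ → ℝ} {φ : ℕ → ℕ} {a : ℝ}
    (hφ : Tendsto φ atTop atTop) (hl : Tendsto l atTop (𝓝 a)) (hle : ∀ n, l n ≤ u (φ n)) :
    (a : EReal) ≤ limsup (fun T => (u T : EReal)) atTop := by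
  have h1 : Tendsto (fun n => (l n : EReal)) atTop (𝓝 (a : EReal)) :=
    (continuous_coe_real_ereal.tendsto a).comp hl
  rw [← h1.limsup_eq]
  calc limsup (fun n => (l n : EReal)) atTop ≤ limsup (fun n => (u (φ n) : EReal)) atTop :=
        limsup_le_limsup (Eventually.of_forall fun n => EReal.coe_le_coe_iff.2 (hle n))
    _ = limsup (fun T => (u T : EReal)) (map φ atTop) := rfl
    _ ≤ limsup (fun T => (u T : EReal)) atTop := limsup_le_limsup_of_le hφ

/-- Limits of the occupation frequencies of the folded states along a subsequence: they satisfy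
the constraints of the linear program with a budget increased in proportion to the limit frequency
`R` of the ages above `X`, and the objective falls short of the cost by at least
`(X - W) * R`. -/
lemma exists_folded_limit (hP : P ∈ Matrix.rowStochastic ℝ (Fin Q))
    (hρ : ρ ∈ stdSimplex ℝ (Fin Q)) (hX : 1 ≤ X) {ω : Fin Q → ℝ} (hω : ∀ q, 0 ≤ ω q)
    {W E : ℝ} (hW : 0 ≤ W) (hπ : IsFeasible P ω E ρ π) :
    ∃ (φ : ℕ → ℕ) (μ y : Fin X → Fin Q → ℝ) (R : ℝ), StrictMono φ ∧ 0 ≤ R ∧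
      IsLPFeasible P ω (E + (∑ q, ω q) * R) X μ y ∧
      ((lpObjective W μ y + (X - W) * R : ℝ) : EReal) ≤ longRunAvg P ρ π (costX W) ∧
      (R = 0 → ∀ (i : Fin X) (q : Fin Q),
        Tendsto (fun n => expAvg P ρ π (indState (i + 1) q) (φ n)) atTop (𝓝 (μ i q)) ∧
        Tendsto (fun n => expAvg P ρ π (indSched (i + 1) q) (φ n)) atTop (𝓝 (y i q))) := by
  let A : ℕ → Fin X → Fin Q → ℝ := fun T i q => expAvg P ρ π (foldState X i q) T
  let B : ℕ → Fin X → Fin Q → ℝ := fun T i q => expAvg P ρ π (foldSched X i q) T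
  let C : ℕ → ℝ := fun T => expAvg P ρ π (fun x q _ => overAge X x q) T
  let D : ℕ → ℝ := fun T => expAvg P ρ π (overNext X) T
  have hA : ∀ T i q, 0 ≤ A T i q ∧ A T i q ≤ 1 := fun T i q =>
    expAvg_mem_Icc hP hρ (fun x q s => by unfold foldState; split_ifs <;> norm_num)
      (fun x q s => by unfold foldState; split_ifs <;> norm_num) T
  have hB : ∀ T i q, 0 ≤ B T i q ∧ B T i q ≤ 1 := fun T i q =>
    expAvg_mem_Icc hP hρ (fun x q s => by unfold foldSched; split_ifs <;> norm_num)
      (fun x q s => by unfold foldSched; split_ifs <;> norm_num) T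
  have hC : ∀ T, 0 ≤ C T ∧ C T ≤ 1 := fun T =>
    expAvg_mem_Icc hP hρ (fun x q s => by unfold overAge; split_ifs <;> norm_num)
      (fun x q s => by unfold overAge; split_ifs <;> norm_num) T
  have hBA : ∀ T i q, B T i q ≤ A T i q := fun T i q => by
    refine expAvg_mono hP hρ (fun x q' s _ => ?_) T
    unfold foldSched foldState
    split_ifs with h1 h2 h2
    · exact le_rfl
    · exact absurd ⟨h1.1, h1.2.1⟩ h2
    · exact zero_le_one
    · exact le_rfl
  obtain ⟨⟨μ, y, R⟩, hmem, φ, hφ, hlim⟩ := (isCompact_Icc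
    (a := (0 : (Fin X → Fin Q → ℝ) × (Fin X → Fin Q → ℝ) × ℝ)) (b := 1)).tendsto_subseq
    (x := fun T => (A T, B T, C T)) fun T =>
      ⟨⟨fun i q => (hA T i q).1, fun i q => (hB T i q).1, (hC T).1⟩,
        ⟨fun i q => (hA T i q).2, fun i q => (hB T i q).2, (hC T).2⟩⟩
  have hφ' := hφ.tendsto_atTop
  have limA : ∀ i q, Tendsto (fun n => A (φ n) i q) atTop (𝓝 (μ i q)) := fun i q =>
    tendsto_pi_nhds.1 (tendsto_pi_nhds.1 hlim.fst_nhds i) q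
  have limB : ∀ i q, Tendsto (fun n => B (φ n) i q) atTop (𝓝 (y i q)) := fun i q =>
    tendsto_pi_nhds.1 (tendsto_pi_nhds.1 hlim.snd_nhds.fst_nhds i) q
  have limC : Tendsto (fun n => C (φ n)) atTop (𝓝 R) := hlim.snd_nhds.snd_nhds
  have limD : Tendsto (fun n => D (φ n)) atTop (𝓝 R) := by
    have h := (tendsto_expAvg_nextCost_sub (π := π) hP hρ (g := overAge X) (M := 1)
      (fun x q => by unfold overAge; split_ifs <;> norm_num)).comp hφ'
    have h2 := h.add limC
    rw [zero_add] at h2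
    refine h2.congr fun n => ?_
    simp only [Function.comp_apply, C, D, sub_add_cancel]
    exact expAvg_congr hP hρ (fun x q s _ => nextCost_overAge hP hX x q s) _
  have hbal : ∀ (i : Fin X) (q : Fin Q), Tendsto (fun n => expAvg P ρ π
      (nextCost P fun x q' => foldState X i q x q' true) (φ n)) atTop (𝓝 (μ i q)) := by
    intro i q
    have h := (tendsto_expAvg_nextCost_sub (π := π) hP hρ
      (g := fun x q' => foldState X i q x q' true) (M := 1)
      (fun x q => by unfold foldState; split_ifs <;> norm_num)).comp hφ'
    have h2 := h.add (limA i q)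
    rw [zero_add] at h2
    refine h2.congr fun n => ?_
    simp only [Function.comp_apply, A]
    exact sub_add_cancel _ _
  refine ⟨φ, μ, y, R, hφ, hmem.1.2.2, ⟨?_, ?_, ?_, ?_, ?_, ?_, ?_⟩, ?_, ?_⟩
  · intro i q hi
    refine tendsto_nhds_unique (hbal i q) ?_
    have h : Tendsto (fun n => ∑ j : Fin X, ∑ q' : Fin Q, P q' q * B (φ n) j q') atTop
        (𝓝 (∑ j : Fin X, ∑ q' : Fin Q, P q' q * y j q')) :=
      tendsto_finsetSum _ fun j _ => tendsto_finsetSum _ fun q' _ =>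
        (limB j q').const_mul _
    simp only [mul_comm (y _ _)]
    refine h.congr fun n => ?_
    rw [hi, expAvg_congr hP hρ fun x q' s hx => nextCost_foldState_zero hX q hx q' s]
    simp only [expAvg_sum, expAvg_const_mul, B]
  · intro i j q hij
    refine tendsto_nhds_unique (hbal j q) ?_
    have h : Tendsto (fun n => ∑ q' : Fin Q, P q' q * (A (φ n) i q' - B (φ n) i q')) atTop
        (𝓝 (∑ q' : Fin Q, P q' q * (μ i q' - y i q'))) :=
      tendsto_finsetSum _ fun q' _ => ((limA i q').sub (limB i q')).const_mul _
    simp only [mul_comm (_ - _)]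
    refine h.congr fun n => ?_
    rw [hij, expAvg_congr hP hρ fun x q' s hx =>
      nextCost_foldState_succ hX (by have := j.2; omega) q hx q' s]
    simp only [expAvg_sum, expAvg_const_mul, expAvg_sub, A, B]
  · have h : Tendsto (fun n => ∑ i : Fin X, ∑ q : Fin Q, A (φ n) i q) atTop
        (𝓝 (∑ i : Fin X, ∑ q : Fin Q, μ i q)) :=
      tendsto_finsetSum _ fun j _ => tendsto_finsetSum _ fun q' _ => limA j q'
    refine tendsto_nhds_unique h (tendsto_const_nhds.congr' ?_)
    filter_upwards [eventually_ge_atTop 1] with n hn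
    -- The empty average `expAvg … 0` is `0` and not `1`, so the time `0` has to be excluded.
    have hn' : φ n ≠ 0 := by
      have := hφ.le_apply (x := n)
      omega
    rw [← expAvg_one (P := P) (ρ := ρ) (π := π) hP hρ hn']
    simp only [A, ← expAvg_sum]
    refine expAvg_congr hP hρ (fun x q s _ => ?_) _
    simpa using (foldState_sum hX (fun _ _ => 1) x q s).symm
  · exact fun i q => le_of_tendsto_of_tendsto' (limB i q) (limA i q) fun n => hBA _ i q
  · have h : Tendsto (fun n => ∑ i : Fin X, ∑ q : Fin Q, ω q * B (φ n) i q -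
        (∑ q, ω q) * D (φ n)) atTop
        (𝓝 (∑ i : Fin X, ∑ q : Fin Q, ω q * y i q - (∑ q, ω q) * R)) :=
      (tendsto_finsetSum _ fun j _ => tendsto_finsetSum _ fun q' _ =>
        (limB j q').const_mul _).sub (limD.const_mul _)
    have h2 := (le_limsup_of_tendsto_subseq (u := expAvg P ρ π (costQ ω)) hφ' h fun n => by
      rw [sub_le_iff_le_add]
      simp only [B, D, ← expAvg_const_mul, ← expAvg_sum, ← expAvg_add]
      exact expAvg_mono hP hρ (fun x q s hx => fold_costQ_le hX hω hx q s) _).trans hπ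
    rw [EReal.coe_le_coe_iff] at h2
    simp only [mul_comm (y _ _)]
    linarith
  · exact fun i q => ⟨hmem.1.1 i q, hmem.2.1 i q⟩
  · exact fun i q => ⟨hmem.1.2.1 i q, hmem.2.2.1 i q⟩
  · have h : Tendsto (fun n => ∑ i : Fin X, ∑ q : Fin Q, (W * B (φ n) i q +
        ((i : ℝ) + 1) * A (φ n) i q) + X * C (φ n) - W * D (φ n)) atTop
        (𝓝 (∑ i : Fin X, ∑ q : Fin Q, (W * y i q + ((i : ℝ) + 1) * μ i q) + X * R - W * R)) :=
      ((tendsto_finsetSum _ fun j _ => tendsto_finsetSum _ fun q' _ =>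
        ((limB j q').const_mul _).add ((limA j q').const_mul _)).add (limC.const_mul _)).sub
        (limD.const_mul _)
    have h2 := le_limsup_of_tendsto_subseq (u := expAvg P ρ π (costX W)) hφ' h fun n => by
      simp only [A, B, C, D, ← expAvg_const_mul, ← expAvg_sum, ← expAvg_add, ← expAvg_sub]
      exact expAvg_mono hP hρ (fun x q s hx => fold_costX_le hX hW hx q s) _
    refine le_trans (le_of_eq ?_) h2
    rw [lpObjective]
    congr 1
    ring
  · rintro rfl i q
    constructor
    · have h := (limA i q).sub limC
      rw [sub_zero] at h
      refine tendsto_of_tendsto_of_tendsto_of_le_of_le h (limA i q) (fun n => ?_) (fun n => ?_)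
      · rw [sub_le_iff_le_add]
        simp only [A, C, ← expAvg_add]
        exact expAvg_mono hP hρ (fun x q' s hx => foldState_sub_le i q hx q' s) _
      · exact expAvg_mono hP hρ (fun x q' s _ => indState_le_foldState i.2 q x q' s) _
    · have h := ((limB i q).sub limC).sub limD
      rw [sub_zero, sub_zero] at h
      refine tendsto_of_tendsto_of_tendsto_of_le_of_le h (limB i q) (fun n => ?_) (fun n => ?_)
      · rw [sub_sub, sub_le_iff_le_add, ← add_assoc]
        simp only [B, C, D, ← expAvg_add]
        exact expAvg_mono hP hρ (fun x q' s hx => foldSched_sub_le i q hx q' s) _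
      · exact expAvg_mono hP hρ (fun x q' s _ => indSched_le_foldSched i.2 q x q' s) _

/-- Convexity jointly in the point and the budget. The two budgets differ in both uses: repairing a
relaxed budget and perturbing towards always scheduling. -/
lemma IsLPFeasible.mix {ω : Fin Q → ℝ} {E₁ E₂ ε : ℝ} {μ₁ y₁ μ₂ y₂ : Fin X → Fin Q → ℝ}
    (h₁ : IsLPFeasible P ω E₁ X μ₁ y₁) (h₂ : IsLPFeasible P ω E₂ X μ₂ y₂) (h0 : 0 ≤ ε)
    (h1 : ε ≤ 1) :
    IsLPFeasible P ω ((1 - ε) * E₁ + ε * E₂) X (fun i q => (1 - ε) * μ₁ i q + ε * μ₂ i q)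
      (fun i q => (1 - ε) * y₁ i q + ε * y₂ i q) := by
  have h1' : 0 ≤ 1 - ε := sub_nonneg.2 h1
  refine ⟨fun i q hi => ?_, fun i j q hij => ?_, ?_, fun i q => ?_, ?_, fun i q => ⟨?_, ?_⟩,
    fun i q => ⟨?_, ?_⟩⟩
  · simp only [h₁.balance_one i q hi, h₂.balance_one i q hi, Finset.mul_sum,
      ← Finset.sum_add_distrib]
    exact Finset.sum_congr rfl fun _ _ => Finset.sum_congr rfl fun _ _ => by ring
  · simp only [h₁.balance_succ i j q hij, h₂.balance_succ i j q hij, Finset.mul_sum,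
      ← Finset.sum_add_distrib]
    exact Finset.sum_congr rfl fun _ _ => by ring
  · simp only [Finset.sum_add_distrib, ← Finset.mul_sum, h₁.normalization, h₂.normalization]
    ring
  · exact add_le_add (mul_le_mul_of_nonneg_left (h₁.y_le_mu i q) h1')
      (mul_le_mul_of_nonneg_left (h₂.y_le_mu i q) h0)
  · simp only [add_mul, mul_assoc, Finset.sum_add_distrib, ← Finset.mul_sum]
    exact add_le_add (mul_le_mul_of_nonneg_left h₁.power h1')
      (mul_le_mul_of_nonneg_left h₂.power h0)
  · exact add_nonneg (mul_nonneg h1' (h₁.mu_mem i q).1) (mul_nonneg h0 (h₂.mu_mem i q).1)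
  · nlinarith [(h₁.mu_mem i q).2, (h₂.mu_mem i q).2]
  · exact add_nonneg (mul_nonneg h1' (h₁.y_mem i q).1) (mul_nonneg h0 (h₂.y_mem i q).1)
  · nlinarith [(h₁.y_mem i q).2, (h₂.y_mem i q).2]

lemma lpObjective_mix (W ε : ℝ) (μ₁ y₁ μ₂ y₂ : Fin X → Fin Q → ℝ) :
    lpObjective W (fun i q => (1 - ε) * μ₁ i q + ε * μ₂ i q)
      (fun i q => (1 - ε) * y₁ i q + ε * y₂ i q) =
      (1 - ε) * lpObjective W μ₁ y₁ + ε * lpObjective W μ₂ y₂ := by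
  simp only [lpObjective, Finset.mul_sum, ← Finset.sum_add_distrib]
  exact Finset.sum_congr rfl fun _ _ => Finset.sum_congr rfl fun _ _ => by ring

lemma IsLPFeasible.mono {ω : Fin Q → ℝ} {E₁ E₂ : ℝ} {μ y : Fin X → Fin Q → ℝ}
    (h : IsLPFeasible P ω E₁ X μ y) (hE : E₁ ≤ E₂) : IsLPFeasible P ω E₂ X μ y :=
  { h with power := h.power.trans hE }

lemma IsLPFeasible.lpObjective_nonneg {ω : Fin Q → ℝ} {W E : ℝ} {μ y : Fin X → Fin Q → ℝ}
    (h : IsLPFeasible P ω E X μ y) (hW : 0 ≤ W) : 0 ≤ lpObjective W μ y :=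
  Finset.sum_nonneg fun i _ => Finset.sum_nonneg fun q _ =>
    add_nonneg (mul_nonneg hW (h.y_mem i q).1)
      (mul_nonneg (by positivity) (h.mu_mem i q).1)

/-- Exact penalty: for a large truncation level, exceeding the budget in proportion to `R` cannot
pay off against the price `(X - W) * R`. -/
lemma exists_lt_of_relaxed {ω : Fin Q → ℝ} (hω : ∀ q, 0 ≤ ω q) {W E R c : ℝ} (hW : 0 ≤ W)
    (hE : 0 < E) (hR : 0 < R) {μ y μ₀ y₀ : Fin X → Fin Q → ℝ}
    (h : IsLPFeasible P ω (E + (∑ q, ω q) * R) X μ y) (h₀ : IsLPFeasible P ω (E / 2) X μ₀ y₀)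
    (hc : lpObjective W μ₀ y₀ ≤ c) (hX : W + 2 * (∑ q, ω q) * c / E < X) :
    ∃ μ' y' : Fin X → Fin Q → ℝ, IsLPFeasible P ω E X μ' y' ∧
      lpObjective W μ' y' < lpObjective W μ y + (X - W) * R := by
  set Ω := ∑ q, ω q with hΩ
  have hΩ0 : 0 ≤ Ω := Finset.sum_nonneg fun q _ => hω q
  have hc0 : 0 ≤ c := (h₀.lpObjective_nonneg hW).trans hc
  have hΩR : 0 ≤ Ω * R := mul_nonneg hΩ0 hR.le
  have hden : 0 < Ω * R + E / 2 := by positivity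
  -- The weight at which the mixed budget `(1 - ε) * (E + Ω * R) + ε * (E / 2)` is exactly `E`; it
  -- is at most proportional to `R`.
  set ε := Ω * R / (Ω * R + E / 2) with hε
  have hε0 : 0 ≤ ε := by positivity
  have hε1 : ε ≤ 1 := (div_le_one hden).2 (by linarith)
  have hεmul : ε * (Ω * R + E / 2) = Ω * R := div_mul_cancel₀ _ hden.ne'
  have hεle : ε ≤ 2 * Ω * R / E := by
    rw [le_div_iff₀ hE]
    nlinarith [mul_nonneg hε0 hΩR]
  refine ⟨_, _, (h.mix h₀ hε0 hε1).mono (by linarith), ?_⟩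
  rw [lpObjective_mix]
  have h1 : ε * lpObjective W μ₀ y₀ ≤ 2 * Ω * R / E * c :=
    mul_le_mul hεle hc (h₀.lpObjective_nonneg hW) (hε0.trans hεle)
  have h2 : 0 ≤ ε * lpObjective W μ y := mul_nonneg hε0 (h.lpObjective_nonneg hW)
  have h3 : 2 * Ω * R / E * c = 2 * Ω * c / E * R := by ring
  have h4 : 2 * Ω * c / E * R < (X - W) * R := mul_lt_mul_of_pos_right (by linarith) hR
  linarith

end LowerBound

end AoI

namespace AoI

/-! ### Stationary vectors and the Poisson equation of a finite stochastic matrix. -/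

section StationaryVectors

open Matrix

variable {n : Type*} [Fintype n]

lemma smul_mem_stdSimplex {w : n → ℝ} (h0 : ∀ i, 0 ≤ w i) (hs : ∑ i, w i ≠ 0) :
    (∑ i, w i)⁻¹ • w ∈ stdSimplex ℝ n := by
  refine ⟨fun i => mul_nonneg (inv_nonneg.2 (Finset.sum_nonneg fun i _ => h0 i)) (h0 i), ?_⟩
  simp only [Pi.smul_apply, smul_eq_mul, ← Finset.mul_sum]
  exact inv_mul_cancel₀ hs

variable [DecidableEq n] {M : Matrix n n ℝ}

lemma sum_vecMul_of_mem_rowStochastic (hM : M ∈ rowStochastic ℝ n) (w : n → ℝ) :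
    ∑ j, (w ᵥ* M) j = ∑ i, w i := by
  simp only [vecMul, dotProduct]
  rw [Finset.sum_comm]
  simp only [← Finset.mul_sum, sum_row_of_mem_rowStochastic hM, mul_one]

/-- The positive part of a stationary vector is stationary. -/
lemma vecMul_max_zero (hM : M ∈ rowStochastic ℝ n) {w : n → ℝ} (hw : w ᵥ* M = w) :
    (fun i => max (w i) 0) ᵥ* M = fun i => max (w i) 0 := by
  have hle : ∀ j ∈ Finset.univ, max (w j) 0 ≤ ((fun i => max (w i) 0) ᵥ* M) j := by
    intro j _
    refine max_le ?_ (nonneg_vecMul_of_mem_rowStochastic hM (fun i => le_max_right _ _) j)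
    conv_lhs => rw [← hw]
    exact Finset.sum_le_sum fun i _ =>
      mul_le_mul_of_nonneg_right (le_max_left _ _) (nonneg_of_mem_rowStochastic hM)
  -- A stochastic matrix preserves total mass, so the coordinatewise inequality must be an equality.
  have heq := (Finset.sum_eq_sum_iff_of_le hle).1 (sum_vecMul_of_mem_rowStochastic hM _).symm
  funext j
  exact (heq j (Finset.mem_univ j)).symm

/-- The constant vector makes `1 - M` singular, so there is also a left null vector; up to sign it
has a nonzero positive part, which is normalized. -/
lemma exists_stationary [Nonempty n] (hM : M ∈ rowStochastic ℝ n) :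
    ∃ μ ∈ stdSimplex ℝ n, μ ᵥ* M = μ := by
  have hdet : (1 - M).det = 0 := by
    refine exists_mulVec_eq_zero_iff.1 ⟨1, one_ne_zero, ?_⟩
    rw [sub_mulVec, one_mulVec, hM.2, sub_self]
  obtain ⟨v, hv0, hv⟩ := exists_vecMul_eq_zero_iff.2 hdet
  rw [vecMul_sub, vecMul_one, sub_eq_zero] at hv
  have key : ∀ w : n → ℝ, w ᵥ* M = w → (∃ i, 0 < w i) → ∃ μ ∈ stdSimplex ℝ n, μ ᵥ* M = μ := by
    rintro w hw ⟨i, hi⟩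
    have hs : ∑ i, max (w i) 0 ≠ 0 := (Finset.sum_pos' (fun i _ => le_max_right _ _)
      ⟨i, Finset.mem_univ i, lt_max_of_lt_left hi⟩).ne'
    exact ⟨_, smul_mem_stdSimplex (fun i => le_max_right (w i) 0) hs, by
      rw [smul_vecMul, vecMul_max_zero hM hw]⟩
  obtain ⟨i, hi⟩ := Function.ne_iff.1 hv0
  rcases lt_or_gt_of_ne hi with h | h
  · exact key (-v) (by rw [neg_vecMul, ← hv]) ⟨i, by simpa using h⟩
  · exact key v hv.symm ⟨i, h⟩

/-- If there is only one stationary distribution, then a signed stationary vector of total mass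
zero vanishes. -/
lemma eq_zero_of_unique_stationary (hM : M ∈ rowStochastic ℝ n) {μ : n → ℝ}
    (huniq : ∀ ν ∈ stdSimplex ℝ n, ν ᵥ* M = ν → ν = μ) {w : n → ℝ} (hw : w ᵥ* M = w)
    (hsum : ∑ i, w i = 0) : w = 0 := by
  have hw' : (-w) ᵥ* M = -w := by rw [neg_vecMul, hw]
  have hp := vecMul_max_zero hM hw
  have hn := vecMul_max_zero hM hw'
  have hdiff : ∀ i, max (w i) 0 - max ((-w) i) 0 = w i := fun i => by
    exact max_zero_sub_max_neg_zero_eq_self (w i)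
  have hss : ∑ i, max (w i) 0 = ∑ i, max ((-w) i) 0 := by
    rw [← sub_eq_zero, ← Finset.sum_sub_distrib, Finset.sum_congr rfl fun i _ => hdiff i, hsum]
  by_cases hs : ∑ i, max (w i) 0 = 0
  · have h1 := (Finset.sum_eq_zero_iff_of_nonneg fun i _ => le_max_right (w i) 0).1 hs
    have h2 := (Finset.sum_eq_zero_iff_of_nonneg fun i _ => le_max_right ((-w) i) 0).1
      (hss ▸ hs)
    funext i
    rw [← hdiff, h1 i (Finset.mem_univ i), h2 i (Finset.mem_univ i), sub_zero, Pi.zero_apply]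
  · have e1 := huniq _ (smul_mem_stdSimplex (fun i => le_max_right (w i) 0) hs)
      (by rw [smul_vecMul, hp])
    have e2 := huniq _ (smul_mem_stdSimplex (fun i => le_max_right ((-w) i) 0) (hss ▸ hs))
      (by rw [smul_vecMul, hn])
    -- Both parts of `w` have the same mass and, once normalized, are the same stationary
    -- distribution; hence they cancel.
    rw [← e2, ← hss] at e1
    have e3 := smul_right_injective _ (inv_ne_zero hs) e1
    funext i
    rw [← hdiff i, congrFun e3 i, sub_self, Pi.zero_apply]

/-- Bounded solutions of the Poisson equation. -/
lemma exists_poisson (hM : M ∈ rowStochastic ℝ n) {μ : n → ℝ} (hμ : ∑ i, μ i = 1)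
    (hμM : μ ᵥ* M = μ) (huniq : ∀ w : n → ℝ, w ᵥ* M = w → ∑ i, w i = 0 → w = 0) :
    ∃ B : ℝ, 0 ≤ B ∧ ∀ f : n → ℝ, (∀ i, |f i| ≤ 1) → ∃ h : n → ℝ, (∀ i, |h i| ≤ B) ∧
      ∀ i, f i = μ ⬝ᵥ f + h i - (M *ᵥ h) i := by
  -- The rank-one term removes the kernel of `1 - M`: if `w ᵥ* A = 0`, summing coordinates gives `∑
  -- i, w i = 0`, so `w` is stationary of mass zero. The solution is then `A⁻¹ *ᵥ f`.
  set A : Matrix n n ℝ := 1 - M + vecMulVec 1 μ with hA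
  have hdet : A.det ≠ 0 := by
    intro h0
    obtain ⟨w, hw0, hw⟩ := exists_vecMul_eq_zero_iff.2 h0
    have h1 : w ᵥ* A = w - w ᵥ* M + (∑ i, w i) • μ := by
      rw [hA, vecMul_add, vecMul_sub, vecMul_one, vecMul_vecMulVec, dotProduct_one]
    have hs : ∑ i, w i = 0 := by
      have h2 : ∑ j, (w ᵥ* A) j = 0 := by simp [hw]
      rw [h1] at h2
      simpa [Finset.sum_add_distrib, Finset.sum_sub_distrib,
        sum_vecMul_of_mem_rowStochastic hM, ← Finset.mul_sum, hμ] using h2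
    rw [h1, hs, zero_smul, add_zero, sub_eq_zero] at hw
    exact hw0 (huniq w hw.symm hs)
  have hunit : IsUnit A.det := isUnit_iff_ne_zero.2 hdet
  -- The bound does not depend on `f`, so switching times can later be fixed before the cost is
  -- known.
  refine ⟨∑ i, ∑ j, |A⁻¹ i j|,
    Finset.sum_nonneg fun i _ => Finset.sum_nonneg fun j _ => abs_nonneg _, fun f hf =>
      ⟨A⁻¹ *ᵥ f, fun i => ?_, fun i => ?_⟩⟩
  · calc |(A⁻¹ *ᵥ f) i| ≤ ∑ j, |A⁻¹ i j * f j| := Finset.abs_sum_le_sum_abs _ _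
      _ ≤ ∑ j, |A⁻¹ i j| := Finset.sum_le_sum fun j _ => by
          rw [abs_mul]
          exact mul_le_of_le_one_right (abs_nonneg _) (hf j)
      _ ≤ _ := Finset.single_le_sum (f := fun i => ∑ j, |A⁻¹ i j|)
          (fun i _ => Finset.sum_nonneg fun j _ => abs_nonneg _) (Finset.mem_univ i)
  · obtain ⟨h, hh⟩ : ∃ h, h = A⁻¹ *ᵥ f := ⟨_, rfl⟩
    rw [← hh]
    have hAh : A *ᵥ h = f := by
      rw [hh, mulVec_mulVec, mul_nonsing_inv A hunit, one_mulVec]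
    have hexp : A *ᵥ h = h - M *ᵥ h + (μ ⬝ᵥ h) • 1 := by
      rw [hA, add_mulVec, sub_mulVec, one_mulVec, vecMulVec_mulVec]
      congr 1
      funext i
      simp
    have hμf : μ ⬝ᵥ f = μ ⬝ᵥ h := by
      rw [← hAh, hexp, dotProduct_add, dotProduct_sub, dotProduct_mulVec, hμM, sub_self, zero_add,
        dotProduct_smul, dotProduct_one, hμ, smul_eq_mul, mul_one]
    have := congrFun (hexp.symm.trans hAh) i
    simp only [Pi.add_apply, Pi.sub_apply, Pi.smul_apply, Pi.one_apply, smul_eq_mul, mul_one] at this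
    rw [hμf, ← this]
    ring

lemma pos_of_stationary (hM : M ∈ rowStochastic ℝ n) {v : n → ℝ} (hv : ∀ i, 0 ≤ v i)
    (hvM : v ᵥ* M = v) {i j : n} (hi : 0 < v i) (hij : 0 < M i j) : 0 < v j := by
  rw [← hvM]
  exact (mul_pos hi hij).trans_le (Finset.single_le_sum (f := fun i => v i * M i j)
    (fun k _ => mul_nonneg (hv k) (nonneg_of_mem_rowStochastic hM)) (Finset.mem_univ i))

end StationaryVectors

/-! ### Steady states of truncated scheduling probabilities. -/

section SteadyState

variable {Q : ℕ} {P : Matrix (Fin Q) (Fin Q) ℝ} {X : ℕ} {ξ : ℕ → Fin Q → unitInterval}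

lemma forall_of_irreducible (hirr : P.IsIrreducible) {S : Fin Q → Prop}
    (hS : ∀ i j, S i → 0 < P i j → S j) {i : Fin Q} (hi : S i) (j : Fin Q) : S j := by
  let := Matrix.toQuiver P
  obtain ⟨p, -⟩ := hirr.connected i j
  induction p with
  | nil => exact hi
  | cons p e ih => exact hS _ _ ih e.down

/-- An irreducible chain has a strictly positive stationary distribution. -/
lemma exists_pos_stationary [NeZero Q] (hP : P ∈ Matrix.rowStochastic ℝ (Fin Q))
    (hirr : P.IsIrreducible) :
    ∃ p : Fin Q → ℝ, (∀ q, 0 < p q) ∧ ∑ q, p q = 1 ∧ ∀ q, ∑ q', p q' * P q' q = p q := by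
  obtain ⟨p, hp, hpP⟩ := exists_stationary hP
  refine ⟨p, ?_, hp.2, fun q => congrFun hpP q⟩
  obtain ⟨i, -, hi⟩ : ∃ i ∈ Finset.univ, 0 < p i := by
    apply Finset.exists_lt_of_sum_lt
    simp [hp.2]
  exact forall_of_irreducible hirr (fun i j => pos_of_stationary hP hp.1 hpP) hi

/-- At age `X` the idle probability is `0`, so cutting off age `X + 1` loses nothing: the finite
matrix predicts like the untruncated process. -/
lemma sum_stateMatrix_mul (hξ : IsTruncated X ξ) (H : ℕ → Fin Q → ℝ) (i : Fin X) (q : Fin Q) :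
    ∑ b : Fin X × Fin Q, stateMatrix P ξ X (i, q) b * H (b.1 + 1) b.2 =
      (ξ (i + 1) q : ℝ) * nextCost P H (i + 1) q true +
        (1 - (ξ (i + 1) q : ℝ)) * nextCost P H (i + 1) q false := by
  have hX : 0 < X := i.pos
  rw [Fintype.sum_prod_type]
  simp only [stateMatrix, Matrix.of_apply, add_mul, Finset.sum_add_distrib, nextCost]
  congr 1
  · rw [Finset.sum_eq_single (⟨0, hX⟩ : Fin X)]
    · simp [Finset.mul_sum, mul_assoc]
    · intro j _ hj
      have : (j : ℕ) ≠ 0 := fun h => hj (Fin.ext h)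
      simp [this]
    · simp
  · by_cases hi : (i : ℕ) + 1 < X
    · rw [Finset.sum_eq_single (⟨i + 1, hi⟩ : Fin X)]
      · simp [Finset.mul_sum, mul_assoc]
      · intro j _ hj
        have : (j : ℕ) ≠ i + 1 := fun h => hj (Fin.ext h)
        simp [this]
      · simp
    · simp [hξ (i + 1) (by omega) q]

lemma stateMatrix_mem_rowStochastic (hP : P ∈ Matrix.rowStochastic ℝ (Fin Q))
    (hξ : IsTruncated X ξ) : stateMatrix P ξ X ∈ Matrix.rowStochastic ℝ (Fin X × Fin Q) := by
  rw [Matrix.mem_rowStochastic_iff_sum]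
  refine ⟨fun a b => ?_, fun a => ?_⟩
  · have h0 := (ξ (a.1 + 1) a.2).2.1
    have h1 := (ξ (a.1 + 1) a.2).2.2
    have hp : 0 ≤ P a.2 b.2 := Matrix.nonneg_of_mem_rowStochastic hP
    have h1' := sub_nonneg.2 h1
    simp only [stateMatrix, Matrix.of_apply]
    positivity
  · have := sum_stateMatrix_mul (P := P) hξ (fun _ _ => 1) a.1 a.2
    simpa [nextCost, Matrix.sum_row_of_mem_rowStochastic hP] using this

lemma vecMul_stateMatrix_zero (v : Fin X × Fin Q → ℝ) (i : Fin X) (q : Fin Q) (hi : (i : ℕ) = 0) :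
    Matrix.vecMul v (stateMatrix P ξ X) (i, q) =
      ∑ j : Fin X, ∑ q', v (j, q') * (ξ (j + 1) q' : ℝ) * P q' q := by
  simp [Matrix.vecMul, dotProduct, Fintype.sum_prod_type, stateMatrix, hi, mul_assoc]

lemma vecMul_stateMatrix_succ (v : Fin X × Fin Q → ℝ) (i j : Fin X) (q : Fin Q)
    (hij : (j : ℕ) = i + 1) :
    Matrix.vecMul v (stateMatrix P ξ X) (j, q) =
      ∑ q', (v (i, q') - v (i, q') * (ξ (i + 1) q' : ℝ)) * P q' q := by
  simp only [Matrix.vecMul, dotProduct, Fintype.sum_prod_type, stateMatrix, Matrix.of_apply, hij]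
  rw [Finset.sum_eq_single i]
  · refine Finset.sum_congr rfl fun q' _ => ?_
    simp
    ring
  · intro k _ hk
    have : ¬ (i : ℕ) = k := fun h => hk (Fin.ext h.symm)
    simp [this]
  · simp

lemma isSteadyState_iff {μ : Fin X → Fin Q → ℝ} :
    IsSteadyState P ξ X μ ↔ (∀ i q, 0 ≤ μ i q) ∧ ∑ i, ∑ q, μ i q = 1 ∧
      (∀ (i : Fin X) (q : Fin Q), (i : ℕ) = 0 →
        μ i q = ∑ j : Fin X, ∑ q' : Fin Q, schedOcc μ ξ j q' * P q' q) ∧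
      (∀ (i j : Fin X) (q : Fin Q), (j : ℕ) = i + 1 →
        μ j q = ∑ q' : Fin Q, (μ i q' - schedOcc μ ξ i q') * P q' q) := by
  constructor
  · rintro ⟨⟨h0, h1⟩, h2⟩
    refine ⟨fun i q => h0 (i, q), by simpa [Fintype.sum_prod_type] using h1, fun i q hi => ?_,
      fun i j q hij => ?_⟩
    · exact (congrFun h2 (i, q)).symm.trans (vecMul_stateMatrix_zero _ i q hi)
    · exact (congrFun h2 (j, q)).symm.trans (vecMul_stateMatrix_succ _ i j q hij)
  · rintro ⟨h0, h1, h2, h3⟩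
    refine ⟨⟨fun a => h0 a.1 a.2, by simpa [Fintype.sum_prod_type] using h1⟩, ?_⟩
    funext ⟨j, q⟩
    rcases Nat.eq_zero_or_pos (j : ℕ) with hj | hj
    · exact (vecMul_stateMatrix_zero _ j q hj).trans (h2 j q hj).symm
    · have hj' : (j : ℕ) = (⟨j - 1, by omega⟩ : Fin X) + 1 := by simp; omega
      exact (vecMul_stateMatrix_succ _ _ j q hj').trans (h3 _ j q hj').symm

/-- If scheduling has positive probability at age `1`, then the chain of the states `(x, q)` has at
most one stationary distribution. -/
lemma eq_zero_of_sched_pos (hP : P ∈ Matrix.rowStochastic ℝ (Fin Q)) (hirr : P.IsIrreducible)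
    (hξ : IsTruncated X ξ) (hpos : ∀ q, 0 < (ξ 1 q : ℝ)) {w : Fin X × Fin Q → ℝ}
    (hw : Matrix.vecMul w (stateMatrix P ξ X) = w) (hsum : ∑ a, w a = 0) : w = 0 := by
  have hK := stateMatrix_mem_rowStochastic hP hξ
  -- A nonnegative stationary vector vanishing at age `1` vanishes at all later ages. Once it
  -- charges age `1`, repeated scheduling at that age and irreducibility spread it over all channel
  -- states. Positive and negative parts of `w` can therefore not both be nonzero.
  have key : ∀ v : Fin X × Fin Q → ℝ, (∀ a, 0 ≤ v a) →
      Matrix.vecMul v (stateMatrix P ξ X) = v → (∃ a, v a ≠ 0) →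
        ∀ (i : Fin X) (q : Fin Q), (i : ℕ) = 0 → 0 < v (i, q) := by
    intro v hv hvK ⟨a, ha⟩ i q hi
    have hex : ∃ q, v (i, q) ≠ 0 := by
      by_contra! hcon
      have hall : ∀ (k : ℕ) (hk : k < X) (q : Fin Q), v (⟨k, hk⟩, q) = 0 := by
        intro k
        induction k with
        | zero =>
          intro hk q
          rw [show (⟨0, hk⟩ : Fin X) = i from Fin.ext hi.symm, hcon]
        | succ k ih =>
          intro hk q
          rw [← congrFun hvK, vecMul_stateMatrix_succ v ⟨k, by omega⟩ _ q rfl]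
          simp [ih]
      exact ha (hall a.1 a.1.2 a.2)
    obtain ⟨q₀, hq₀⟩ := hex
    refine forall_of_irreducible hirr (S := fun q => 0 < v (i, q)) (fun j k hj hjk => ?_)
      (lt_of_le_of_ne (hv _) hq₀.symm) q
    refine pos_of_stationary hK hv hvK hj ?_
    have := mul_pos (hpos j) hjk
    simpa [stateMatrix, hi] using this
  by_contra hne
  obtain ⟨a, ha⟩ := Function.ne_iff.1 hne
  have hX : 0 < X := a.1.pos
  have hex : (∃ a, 0 < w a) ∧ ∃ a, w a < 0 := by
    constructor
    · by_contra! hcon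
      exact ha ((Finset.sum_eq_zero_iff_of_nonpos fun a _ => hcon a).1 hsum a (Finset.mem_univ a))
    · by_contra! hcon
      exact ha ((Finset.sum_eq_zero_iff_of_nonneg fun a _ => hcon a).1 hsum a (Finset.mem_univ a))
  obtain ⟨⟨b, hb⟩, c, hc⟩ := hex
  have h1 := key _ (fun i => le_max_right (w i) 0) (vecMul_max_zero hK hw)
    ⟨b, (lt_max_of_lt_left hb).ne'⟩ ⟨0, hX⟩ b.2 rfl
  have h2 := key _ (fun i => le_max_right ((-w) i) 0)
    (vecMul_max_zero hK (by rw [Matrix.neg_vecMul, hw]))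
    ⟨c, (lt_max_of_lt_left (by simpa using hc)).ne'⟩ ⟨0, hX⟩ b.2 rfl
  rcases lt_max_iff.1 h1 with h1 | h1
  · rcases lt_max_iff.1 h2 with h2 | h2
    · simp only [Pi.neg_apply] at h2
      linarith
    · exact lt_irrefl _ h2
  · exact lt_irrefl _ h1

end SteadyState

/-! ### Feasible points and solvability of the linear program. -/

section LinearProgram

variable {Q : ℕ} {P : Matrix (Fin Q) (Fin Q) ℝ} {X : ℕ} {ω : Fin Q → ℝ} {W E : ℝ}

/-- At the maximal age every feasible point of the linear program always schedules. -/
lemma IsLPFeasible.y_eq_mu_last (hP : P ∈ Matrix.rowStochastic ℝ (Fin Q))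
    {μ y : Fin X → Fin Q → ℝ} (h : IsLPFeasible P ω E X μ y) (i : Fin X) (hi : (i : ℕ) + 1 = X)
    (q : Fin Q) : y i q = μ i q := by
  obtain ⟨n, rfl⟩ : ∃ n, X = n + 1 := ⟨X - 1, by omega⟩
  obtain rfl : i = Fin.last n := Fin.ext (by simpa using hi)
  have hrow : ∀ c : Fin Q → ℝ, ∑ q, ∑ q', c q' * P q' q = ∑ q', c q' := fun c => by
    rw [Finset.sum_comm]
    simp only [← Finset.mul_sum, Matrix.sum_row_of_mem_rowStochastic hP, mul_one]
  have h0 : ∑ q, μ 0 q = ∑ j, ∑ q, y j q := by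
    rw [Finset.sum_congr rfl fun q _ => h.balance_one 0 q rfl, Finset.sum_comm]
    exact Finset.sum_congr rfl fun j _ => hrow _
  have h1 : ∀ j : Fin n, ∑ q, μ j.succ q = ∑ q, μ j.castSucc q - ∑ q, y j.castSucc q := by
    intro j
    rw [Finset.sum_congr rfl fun q _ => h.balance_succ j.castSucc j.succ q (by simp), hrow,
      Finset.sum_sub_distrib]
  -- The mass at age `1` is the total scheduled mass, and each later age carries what its
  -- predecessor left unscheduled. Comparing total masses leaves nothing unscheduled at the last
  -- age.
  have h2 : ∑ q, (μ (Fin.last n) q - y (Fin.last n) q) = 0 := by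
    have e1 := Fin.sum_univ_succ fun i => ∑ q, μ i q
    rw [Fin.sum_univ_castSucc, h0, Fin.sum_univ_castSucc,
      Finset.sum_congr rfl fun j _ => h1 j, Finset.sum_sub_distrib] at e1
    rw [Finset.sum_sub_distrib]
    linarith
  have h3 := (Finset.sum_eq_zero_iff_of_nonneg fun q _ =>
    sub_nonneg.2 (h.y_le_mu (Fin.last n) q)).1 h2 q (Finset.mem_univ q)
  linarith

lemma IsLPFeasible.exists_sched (hP : P ∈ Matrix.rowStochastic ℝ (Fin Q))
    {μ y : Fin X → Fin Q → ℝ} (h : IsLPFeasible P ω E X μ y) :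
    ∃ ξ : ℕ → Fin Q → unitInterval, IsTruncated X ξ ∧ IsSteadyState P ξ X μ ∧
      y = schedOcc μ ξ := by
  classical
  -- Where `μ` vanishes the quotient is `0` and its value is immaterial. Age `0` reuses index `0`,
  -- but no state has that age.
  let ξ : ℕ → Fin Q → unitInterval := fun x q =>
    if hx : x < X then Set.projIcc 0 1 zero_le_one
      (y ⟨x - 1, by omega⟩ q / μ ⟨x - 1, by omega⟩ q) else 1
  have hy : y = schedOcc μ ξ := by
    funext i q
    by_cases hi : (i : ℕ) + 1 < X
    · have hmem : y i q / μ i q ∈ Set.Icc (0 : ℝ) 1 :=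
        ⟨div_nonneg (h.y_mem i q).1 (h.mu_mem i q).1,
          div_le_one_of_le₀ (h.y_le_mu i q) (h.mu_mem i q).1⟩
      have : (ξ (i + 1) q : ℝ) = y i q / μ i q := by
        simp only [ξ, hi, dif_pos, Nat.add_sub_cancel, Fin.eta]
        rw [Set.projIcc_of_mem zero_le_one hmem]
      rw [schedOcc, this]
      rcases eq_or_ne (μ i q) 0 with h0 | h0
      · have := h.y_le_mu i q
        have := (h.y_mem i q).1
        rw [h0, zero_mul]
        linarith
      · rw [mul_div_cancel₀ _ h0]
    · simp [schedOcc, ξ, hi, h.y_eq_mu_last hP i (by omega) q]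
  refine ⟨ξ, fun x hx q => by simp [ξ, Nat.not_lt.2 hx], ?_, hy⟩
  rw [isSteadyState_iff, ← hy]
  exact ⟨fun i q => (h.mu_mem i q).1, h.normalization, h.balance_one, h.balance_succ⟩

lemma schedOcc_nonneg {μ : Fin X → Fin Q → ℝ} {ξ : ℕ → Fin Q → unitInterval} {i : Fin X}
    {q : Fin Q} (h : 0 ≤ μ i q) : 0 ≤ schedOcc μ ξ i q :=
  mul_nonneg h (ξ (i + 1) q).2.1

lemma schedOcc_le {μ : Fin X → Fin Q → ℝ} {ξ : ℕ → Fin Q → unitInterval} {i : Fin X}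
    {q : Fin Q} (h : 0 ≤ μ i q) : schedOcc μ ξ i q ≤ μ i q :=
  mul_le_of_le_one_right h (ξ (i + 1) q).2.2

lemma IsSteadyState.isLPFeasible {μ : Fin X → Fin Q → ℝ} {ξ : ℕ → Fin Q → unitInterval}
    (h : IsSteadyState P ξ X μ)
    (hE : ∑ i : Fin X, ∑ q : Fin Q, schedOcc μ ξ i q * ω q ≤ E) :
    IsLPFeasible P ω E X μ (schedOcc μ ξ) := by
  obtain ⟨h0, h1, h2, h3⟩ := isSteadyState_iff.1 h
  have hle : ∀ i q, μ i q ≤ 1 := fun i q => by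
    rw [← h1]
    exact (Finset.single_le_sum (fun q _ => h0 i q) (Finset.mem_univ q)).trans
      (Finset.single_le_sum (f := fun i => ∑ q, μ i q)
        (fun i _ => Finset.sum_nonneg fun q _ => h0 i q) (Finset.mem_univ i))
  exact ⟨h2, h3, h1, fun i q => schedOcc_le (h0 i q), hE, fun i q => ⟨h0 i q, hle i q⟩,
    fun i q => ⟨schedOcc_nonneg (h0 i q), (schedOcc_le (h0 i q)).trans (hle i q)⟩⟩

lemma isLPFeasible_iff_exists_sched (hP : P ∈ Matrix.rowStochastic ℝ (Fin Q))
    (μ y : Fin X → Fin Q → ℝ) :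
    IsLPFeasible P ω E X μ y ↔
      ∃ ξ : ℕ → Fin Q → unitInterval, IsTruncated X ξ ∧ IsSteadyState P ξ X μ ∧
        y = schedOcc μ ξ ∧ ∑ i : Fin X, ∑ q : Fin Q, μ i q * (ξ (i + 1) q : ℝ) * ω q ≤ E := by
  constructor
  · intro h
    obtain ⟨ξ, hξ, hs, rfl⟩ := h.exists_sched hP
    exact ⟨ξ, hξ, hs, rfl, h.power⟩
  · rintro ⟨ξ, -, hs, rfl, hE⟩
    exact hs.isLPFeasible hE

/-- The occupation measure of the policy that schedules exactly at the age `N`. -/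
lemma isLPFeasible_threshold {p : Fin Q → ℝ} (hp : ∀ q, 0 < p q) (hp1 : ∑ q, p q = 1)
    (hpP : ∀ q, ∑ q', p q' * P q' q = p q) {N : ℕ} (hN : 1 ≤ N) (hNX : N ≤ X) :
    IsLPFeasible P ω ((∑ q, p q * ω q) / N) X (fun i q => if (i : ℕ) < N then p q / N else 0)
      (fun i q => if (i : ℕ) + 1 = N then p q / N else 0) := by
  have hN0 : (0 : ℝ) < N := by exact_mod_cast hN
  have hN1 : (1 : ℝ) ≤ N := by exact_mod_cast hN
  have hple : ∀ q, p q ≤ 1 := fun q => by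
    rw [← hp1]
    exact Finset.single_le_sum (fun q _ => (hp q).le) (Finset.mem_univ q)
  have hpN : ∀ q, 0 ≤ p q / N ∧ p q / N ≤ 1 := fun q =>
    ⟨(div_pos (hp q) hN0).le, (div_le_one hN0).2 ((hple q).trans hN1)⟩
  have hbal : ∀ q, ∑ q', p q' / N * P q' q = p q / N := fun q => by
    rw [← hpP q, Finset.sum_div]
    exact Finset.sum_congr rfl fun q' _ => by ring
  have hsched : ∀ c : Fin Q → ℝ, ∑ i : Fin X, ∑ q : Fin Q,
      (if (i : ℕ) + 1 = N then p q / N else 0) * c q = ∑ q, p q / N * c q := fun c => by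
    rw [Finset.sum_eq_single (⟨N - 1, by omega⟩ : Fin X)]
    · simp [Nat.sub_add_cancel hN]
    · intro i _ hi
      have : (i : ℕ) + 1 ≠ N := fun h => hi (Fin.ext (by simp; omega))
      simp [this]
    · simp
  refine ⟨fun i q hi => ?_, fun i j q hij => ?_, ?_, fun i q => ?_, ?_, fun i q => ?_,
    fun i q => ?_⟩
  · rw [hsched, hbal, hi, if_pos (by omega)]
  · by_cases h : (j : ℕ) < N
    · have h1 : (i : ℕ) < N := by omega
      have h2 : (i : ℕ) + 1 ≠ N := by omega
      simp [h, h1, h2, hbal]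
    · have h3 : (i : ℕ) < N ↔ (i : ℕ) + 1 = N := by omega
      simp [h, h3]
  · have h1 : ∀ i : Fin X, ∑ q, (if (i : ℕ) < N then p q / N else 0) =
        if (i : ℕ) < N then (1 : ℝ) / N else 0 := fun i => by
      split_ifs
      · rw [← Finset.sum_div, hp1]
      · simp
    rw [Finset.sum_congr rfl fun i _ => h1 i,
      Fin.sum_univ_eq_sum_range (fun i => if i < N then (1 : ℝ) / N else 0), ← Finset.sum_filter]
    have : (Finset.range X).filter (· < N) = Finset.range N := by
      ext k
      simp only [Finset.mem_filter, Finset.mem_range]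
      omega
    rw [this, Finset.sum_const, Finset.card_range, nsmul_eq_mul, mul_one_div_cancel hN0.ne']
  · by_cases h : (i : ℕ) + 1 = N
    · rw [if_pos h, if_pos (by omega)]
    · rw [if_neg h]
      split_ifs
      · exact (hpN q).1
      · exact le_rfl
  · rw [hsched, Finset.sum_div]
    exact (Finset.sum_congr rfl fun q _ => by ring).le
  · split_ifs
    · exact hpN q
    · norm_num
  · split_ifs
    · exact hpN q
    · norm_num

lemma lpObjective_threshold_le {p : Fin Q → ℝ} (hp : ∀ q, 0 < p q) (hp1 : ∑ q, p q = 1)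
    (hpP : ∀ q, ∑ q', p q' * P q' q = p q) (hW : 0 ≤ W) {N : ℕ} (hN : 1 ≤ N) (hNX : N ≤ X) :
    lpObjective (X := X) W (fun i q => if (i : ℕ) < N then p q / N else 0)
      (fun i q => if (i : ℕ) + 1 = N then p q / N else 0) ≤ W + N := by
  -- Only the balance and mass constraints are needed, so the power weights are taken to be zero.
  have h := isLPFeasible_threshold (ω := fun _ => (0 : ℝ)) hp hp1 hpP hN hNX
  calc lpObjective (X := X) W (fun i q => if (i : ℕ) < N then p q / N else 0)
        (fun i q => if (i : ℕ) + 1 = N then p q / N else 0)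
      ≤ ∑ i : Fin X, ∑ q, (W + N) * (if (i : ℕ) < N then p q / N else 0) := by
        refine Finset.sum_le_sum fun i _ => Finset.sum_le_sum fun q _ => ?_
        rw [add_mul W (N : ℝ)]
        refine add_le_add (mul_le_mul_of_nonneg_left (h.y_le_mu i q) hW) ?_
        have h0 := (h.mu_mem i q).1
        by_cases hi : (i : ℕ) < N
        · exact mul_le_mul_of_nonneg_right (by exact_mod_cast hi) h0
        · simp [hi]
    _ = W + N := by
        simp only [← Finset.mul_sum]
        rw [h.normalization, mul_one]

lemma isCompact_setOf_isLPFeasible :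
    IsCompact {z : (Fin X → Fin Q → ℝ) × (Fin X → Fin Q → ℝ) | IsLPFeasible P ω E X z.1 z.2} := by
  have hset : {z : (Fin X → Fin Q → ℝ) × (Fin X → Fin Q → ℝ) | IsLPFeasible P ω E X z.1 z.2} =
      Set.Icc 0 1 ∩ ({z | ∀ (i : Fin X) (q : Fin Q), (i : ℕ) = 0 →
          z.1 i q = ∑ j : Fin X, ∑ q' : Fin Q, z.2 j q' * P q' q} ∩
        ({z | ∀ (i j : Fin X) (q : Fin Q), (j : ℕ) = i + 1 →
          z.1 j q = ∑ q' : Fin Q, (z.1 i q' - z.2 i q') * P q' q} ∩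
        ({z | ∑ i : Fin X, ∑ q : Fin Q, z.1 i q = 1} ∩ ({z | ∀ i q, z.2 i q ≤ z.1 i q} ∩
        {z | ∑ i : Fin X, ∑ q : Fin Q, z.2 i q * ω q ≤ E})))) := by
    ext z
    constructor
    · intro h
      exact ⟨⟨⟨fun i q => (h.mu_mem i q).1, fun i q => (h.y_mem i q).1⟩,
        ⟨fun i q => (h.mu_mem i q).2, fun i q => (h.y_mem i q).2⟩⟩, h.balance_one,
        h.balance_succ, h.normalization, h.y_le_mu, h.power⟩
    · rintro ⟨⟨h0, h1⟩, h2, h3, h4, h5, h6⟩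
      exact ⟨h2, h3, h4, h5, h6, fun i q => ⟨h0.1 i q, h1.1 i q⟩,
        fun i q => ⟨h0.2 i q, h1.2 i q⟩⟩
  rw [hset]
  refine isCompact_Icc.inter_right (IsClosed.inter ?_ (IsClosed.inter ?_ (IsClosed.inter ?_
    (IsClosed.inter ?_ ?_))))
  · simp only [Set.ofPred_forall]
    exact isClosed_iInter fun i => isClosed_iInter fun q => isClosed_iInter fun _ =>
      isClosed_eq (by fun_prop) (by fun_prop)
  · simp only [Set.ofPred_forall]
    exact isClosed_iInter fun i => isClosed_iInter fun j => isClosed_iInter fun q =>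
      isClosed_iInter fun _ => isClosed_eq (by fun_prop) (by fun_prop)
  · exact isClosed_eq (by fun_prop) (by fun_prop)
  · simp only [Set.ofPred_forall]
    exact isClosed_iInter fun i => isClosed_iInter fun q => isClosed_le (by fun_prop) (by fun_prop)
  · exact isClosed_le (by fun_prop) (by fun_prop)

lemma exists_isLPOptimal {μ y : Fin X → Fin Q → ℝ} (h : IsLPFeasible P ω E X μ y) :
    ∃ μ y : Fin X → Fin Q → ℝ, IsLPOptimal P ω W E X μ y := by
  obtain ⟨z, hz, hmin⟩ := isCompact_setOf_isLPFeasible.exists_isMinOn ⟨(μ, y), h⟩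
    (f := fun z : (Fin X → Fin Q → ℝ) × (Fin X → Fin Q → ℝ) => lpObjective W z.1 z.2)
    (by unfold lpObjective; fun_prop)
  exact ⟨z.1, z.2, hz, fun μ' y' h' => hmin (a := (μ', y')) h'⟩

end LinearProgram

end AoI

namespace AoI

/-! ### Realizing feasible points by slowly switching policies. -/

section Ergodic

variable {Q : ℕ} {P : Matrix (Fin Q) (Fin Q) ℝ} {ρ : Fin Q → ℝ} {X : ℕ}

lemma age_le_of_pathProb_ne_zero {π : Policy Q} (hX : 1 ≤ X)
    (hπ : ∀ h q, X ≤ age h → π h q = 1) (h : List (Fin Q × Bool))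
    (hh : pathProb P ρ π h ≠ 0) : age h ≤ X := by
  induction h with
  | nil => simpa [age] using hX
  | cons a h ih =>
    obtain ⟨q, s⟩ := a
    cases s
    · by_contra! hlt
      have : X ≤ age h := by simpa [age, Nat.lt_succ_iff] using hlt
      simp [pathProb, decisionProb, hπ h q this] at hh
    · simpa [age] using hX

/-- A sequence of indices that grows by at most one per step and so slowly that `S` along it is
negligible compared with time. -/
lemma exists_slow_index (S : ℕ → ℝ) :
    ∃ k : ℕ → ℕ, k 0 = 0 ∧ (∀ t, k (t + 1) = k t ∨ k (t + 1) = k t + 1) ∧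
      Tendsto k atTop atTop ∧ Tendsto (fun t => S (k t) / t) atTop (𝓝 0) := by
  classical
  -- The index advances only when time has caught up, which preserves `k t * |S (k t)| ≤ t` and so
  -- gives `|S (k t)| / t ≤ 1 / k t`.
  obtain ⟨k, hk0, hk⟩ : ∃ k : ℕ → ℕ, k 0 = 0 ∧ ∀ t, k (t + 1) =
      if ((k t + 1 : ℕ) : ℝ) * |S (k t + 1)| ≤ (t + 1 : ℕ) then k t + 1 else k t :=
    ⟨fun t => Nat.rec (motive := fun _ => ℕ) 0
      (fun t n => if ((n + 1 : ℕ) : ℝ) * |S (n + 1)| ≤ (t + 1 : ℕ) then n + 1 else n) t,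
      rfl, fun _ => rfl⟩
  have hstep : ∀ t, k (t + 1) = k t ∨ k (t + 1) = k t + 1 := fun t => by
    rw [hk]
    split_ifs <;> simp
  have hmono : Monotone k := monotone_nat_of_le_succ fun t => by
    rcases hstep t with h | h <;> omega
  have htop : Tendsto k atTop atTop := by
    refine tendsto_atTop_atTop_of_monotone hmono fun N => ?_
    induction N with
    | zero => exact ⟨0, Nat.zero_le _⟩
    | succ N ih =>
      obtain ⟨t₀, ht₀⟩ := ih
      by_contra! hcon
      obtain ⟨t₁, ht₁⟩ := exists_nat_ge (((N + 1 : ℕ) : ℝ) * |S (N + 1)|)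
      have hkN : k (max t₀ t₁) = N := le_antisymm (Nat.lt_succ_iff.1 (hcon _))
        (ht₀.trans (hmono (le_max_left _ _)))
      have hle : ((N + 1 : ℕ) : ℝ) * |S (N + 1)| ≤ (max t₀ t₁ + 1 : ℕ) :=
        ht₁.trans (by exact_mod_cast (le_max_right t₀ t₁).trans (Nat.le_succ _))
      have h1 := hk (max t₀ t₁)
      rw [hkN, if_pos hle] at h1
      have := hcon (max t₀ t₁ + 1)
      omega
  have hinv : ∀ t : ℕ, (k t : ℝ) * |S (k t)| ≤ t := by
    intro t
    induction t with
    | zero => simp [hk0]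
    | succ t ih =>
      rw [hk]
      split_ifs with h
      · exact h
      · exact ih.trans (by exact_mod_cast Nat.le_succ t)
  refine ⟨k, hk0, hstep, htop, ?_⟩
  refine squeeze_zero_norm' (a := fun t => ((k t : ℝ))⁻¹) ?_
    (tendsto_inv_atTop_zero.comp (tendsto_natCast_atTop_atTop.comp htop))
  filter_upwards [htop.eventually_ge_atTop 1, eventually_ge_atTop 1] with t h1 h2
  have h1' : (0 : ℝ) < k t := by exact_mod_cast h1
  have h2' : (0 : ℝ) < t := by exact_mod_cast h2
  rw [Real.norm_eq_abs, abs_div, Nat.abs_cast, div_le_iff₀ h2', ← div_eq_inv_mul,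
    le_div_iff₀ h1', mul_comm]
  exact hinv t

/-- Ergodic theorem for a policy that switches, slowly, through a sequence of truncated stationary
policies with unique and converging steady states. -/
lemma exists_tendsto_expAvg (hP : P ∈ Matrix.rowStochastic ℝ (Fin Q))
    (hX : 1 ≤ X) {ξ : ℕ → ℕ → Fin Q → unitInterval} (hξ : ∀ n, IsTruncated X (ξ n))
    {μs : ℕ → Fin X → Fin Q → ℝ} (hμs : ∀ n, IsSteadyState P (ξ n) X (μs n))
    (huniq : ∀ n (w : Fin X × Fin Q → ℝ), Matrix.vecMul w (stateMatrix P (ξ n) X) = w →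
      ∑ a, w a = 0 → w = 0)
    {μ y : Fin X → Fin Q → ℝ} (hμ : ∀ i q, Tendsto (fun n => μs n i q) atTop (𝓝 (μ i q)))
    (hy : ∀ i q, Tendsto (fun n => schedOcc (μs n) (ξ n) i q) atTop (𝓝 (y i q))) :
    ∃ k : ℕ → ℕ, ∀ ρ ∈ stdSimplex ℝ (Fin Q), ∀ c : ℕ → Fin Q → Bool → ℝ,
      Tendsto (expAvg P ρ (fun h q => ξ (k h.length) (age h) q) c) atTop
        (𝓝 (∑ i : Fin X, ∑ q,
          (y i q * c (i + 1) q true + (μ i q - y i q) * c (i + 1) q false))) := by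
  have hpoi := fun n => exists_poisson (stateMatrix_mem_rowStochastic hP (hξ n)) (hμs n).1.2
    (hμs n).2 (huniq n)
  choose B hB0 hB using hpoi
  obtain ⟨k, hk0, hkstep, hktop, hkS⟩ :=
    -- Twice the sum of the Poisson bounds used so far dominates the accumulated error, including
    -- the boundary term; see `hbound`.
    exists_slow_index fun j => 2 * ∑ l ∈ Finset.range (j + 1), B l
  refine ⟨k, fun ρ hρ c => ?_⟩
  set π : Policy Q := fun h q => ξ (k h.length) (age h) q with hπ
  suffices hbdd : ∀ c : ℕ → Fin Q → Bool → ℝ,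
      (∀ (i : Fin X) q s, |c (i + 1) q s| ≤ 1) → Tendsto (expAvg P ρ π c) atTop
        (𝓝 (∑ i : Fin X, ∑ q,
          (y i q * c (i + 1) q true + (μ i q - y i q) * c (i + 1) q false))) by
    set C := 1 + ∑ i : Fin X, ∑ q, ∑ s, |c (i + 1) q s| with hC
    have hCpos : 0 < C := by positivity
    have hle : ∀ (i : Fin X) q s, |c (i + 1) q s| ≤ C := fun i q s => by
      have h1 := Finset.single_le_sum (f := fun s => |c (i + 1) q s|)
        (fun s _ => abs_nonneg _) (Finset.mem_univ s)
      have h2 := Finset.single_le_sum (f := fun q => ∑ s, |c (i + 1) q s|)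
        (fun q _ => Finset.sum_nonneg fun s _ => abs_nonneg _) (Finset.mem_univ q)
      have h3 := Finset.single_le_sum (f := fun i : Fin X => ∑ q, ∑ s, |c (i + 1) q s|)
        (fun i _ => Finset.sum_nonneg fun q _ => Finset.sum_nonneg fun s _ => abs_nonneg _)
        (Finset.mem_univ i)
      linarith
    have h := (hbdd (fun x q s => C⁻¹ * c x q s) fun i q s => by
      rw [abs_mul, abs_of_pos (inv_pos.2 hCpos), inv_mul_le_one₀ hCpos]
      exact hle i q s).const_mul C
    have hlim : C * ∑ i : Fin X, ∑ q, (y i q * (C⁻¹ * c (i + 1) q true) +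
        (μ i q - y i q) * (C⁻¹ * c (i + 1) q false)) = ∑ i : Fin X, ∑ q,
          (y i q * c (i + 1) q true + (μ i q - y i q) * c (i + 1) q false) := by
      simp only [Finset.mul_sum]
      refine Finset.sum_congr rfl fun i _ => Finset.sum_congr rfl fun q _ => ?_
      field_simp
    rw [hlim] at h
    refine h.congr fun T => ?_
    rw [expAvg_const_mul, mul_inv_cancel_left₀ hCpos.ne']
  intro c hc
  let f : ℕ → Fin X × Fin Q → ℝ := fun n a =>
    (ξ n (a.1 + 1) a.2 : ℝ) * c (a.1 + 1) a.2 true +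
      (1 - (ξ n (a.1 + 1) a.2 : ℝ)) * c (a.1 + 1) a.2 false
  have hf : ∀ n a, |f n a| ≤ 1 := fun n a => by
    have h0 := (ξ n (a.1 + 1) a.2).2.1
    have h1 := (ξ n (a.1 + 1) a.2).2.2
    have ht := abs_le.1 (hc a.1 a.2 true)
    have hf := abs_le.1 (hc a.1 a.2 false)
    rw [abs_le]
    constructor <;> nlinarith
  choose g hgB hg using fun n => hB n (f n) (hf n)
  -- Extension by `0` beyond age `X` keeps the bound `B n` on all paths; paths of positive
  -- probability never get there.
  let H : ℕ → ℕ → Fin Q → ℝ := fun n x q => if hx : x - 1 < X then g n (⟨x - 1, hx⟩, q) else 0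
  have hHB : ∀ n x q, |H n x q| ≤ B n := fun n x q => by
    simp only [H]
    split_ifs
    · exact hgB n _
    · simpa using hB0 n
  have hHg : ∀ n (i : Fin X) q, H n (i + 1) q = g n (i, q) := fun n i q => by simp [H]
  let m : ℕ → ℝ := fun n => Function.uncurry (μs n) ⬝ᵥ f n
  have hm : Tendsto m atTop (𝓝 (∑ i : Fin X, ∑ q,
      (y i q * c (i + 1) q true + (μ i q - y i q) * c (i + 1) q false))) := by
    have h : Tendsto (fun n => ∑ i : Fin X, ∑ q, (schedOcc (μs n) (ξ n) i q * c (i + 1) q true +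
        (μs n i q - schedOcc (μs n) (ξ n) i q) * c (i + 1) q false)) atTop (𝓝 (∑ i : Fin X, ∑ q,
      (y i q * c (i + 1) q true + (μ i q - y i q) * c (i + 1) q false))) :=
      tendsto_finsetSum _ fun i _ => tendsto_finsetSum _ fun q _ =>
        ((hy i q).mul_const _).add (((hμ i q).sub (hy i q)).mul_const _)
    refine h.congr fun n => ?_
    simp only [m, dotProduct, Fintype.sum_prod_type, f, schedOcc, Function.uncurry]
    exact Finset.sum_congr rfl fun i _ => Finset.sum_congr rfl fun q _ => by ring
  have hpoisson : ∀ n (i : Fin X) q, f n (i, q) = m n + H n (i + 1) q -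
      ((ξ n (i + 1) q : ℝ) * nextCost P (H n) (i + 1) q true +
        (1 - (ξ n (i + 1) q : ℝ)) * nextCost P (H n) (i + 1) q false) := fun n i q => by
    rw [hg n (i, q), hHg, ← sum_stateMatrix_mul (hξ n)]
    simp only [hHg]
    rfl
  have hstep : ∀ t, pathExp P ρ π t (condCost P ρ π c) = m (k t) +
      pathExp P ρ π t (condState P ρ (H (k t))) -
        pathExp P ρ π (t + 1) (condState P ρ (H (k t))) := by
    intro t
    rw [pathExp_succ_condState, ← pathExp_const (π := π) hP hρ t (m (k t)), ← pathExp_add,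
      ← pathExp_sub]
    refine pathExp_congr_of_pathProb fun h hlen hprob => ?_
    have hage := age_le_of_pathProb_ne_zero hX
      (fun h q hh => by rw [hπ]; exact hξ _ _ hh q) h hprob
    have hage1 := one_le_age h
    obtain ⟨i, hi⟩ : ∃ i : Fin X, age h = i + 1 := ⟨⟨age h - 1, by omega⟩, by simp; omega⟩
    have hcp : m (k t) = ∑ q, channelProb P ρ h q * m (k t) := by
      rw [← Finset.sum_mul, sum_channelProb hP hρ, one_mul]
    simp only [condCost, condState]
    rw [hcp, ← Finset.sum_add_distrib, ← Finset.sum_sub_distrib]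
    refine Finset.sum_congr rfl fun q _ => ?_
    have hp := hpoisson (k t) i q
    simp only [f] at hp
    simp only [Fintype.sum_bool, decisionProb, hπ, hlen, hi, if_true, Bool.false_eq_true, if_false]
    rw [hp]
    ring
  -- While `k` is constant the sum telescopes. A switch replaces one Poisson solution by the next
  -- and costs at most `B (k T) + B (k T + 1)`.
  have hbound : ∀ T, |∑ t ∈ Finset.range T, (pathExp P ρ π t (condCost P ρ π c) - m (k t)) +
      pathExp P ρ π T (condState P ρ (H (k T)))| ≤
        2 * ∑ l ∈ Finset.range (k T), B l + B (k T) := by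
    have hE : ∀ T n, |pathExp P ρ π T (condState P ρ (H n))| ≤ B n := fun T n =>
      abs_pathExp_le hP hρ (abs_condState_le hP hρ (hHB n))
    intro T
    induction T with
    | zero => simpa [hk0] using hE 0 0
    | succ T ih =>
      rw [Finset.sum_range_succ, hstep T]
      rcases hkstep T with h | h
      · rw [h]
        convert ih using 2
        ring
      · rw [h, Finset.sum_range_succ]
        have h1 := abs_le.1 ih
        have h2 := abs_le.1 (hE (T + 1) (k T))
        have h3 := abs_le.1 (hE (T + 1) (k T + 1))
        rw [abs_le]
        constructor <;> linarith
  have hsum : Tendsto (fun T : ℕ => (∑ t ∈ Finset.range T,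
      (pathExp P ρ π t (condCost P ρ π c) - m (k t))) / T) atTop (𝓝 0) := by
    refine squeeze_zero_norm (fun T => ?_) hkS
    rw [Real.norm_eq_abs, abs_div, Nat.abs_cast]
    refine div_le_div_of_nonneg_right ?_ (Nat.cast_nonneg T)
    have h1 := abs_le.1 (hbound T)
    have h2 := abs_le.1 (abs_pathExp_le (π := π) (T := T) hP hρ
      (abs_condState_le hP hρ (hHB (k T))))
    rw [Finset.sum_range_succ, abs_le]
    constructor <;> linarith
  have hces := (hm.comp hktop).cesaro
  have := hsum.add hces
  rw [zero_add] at this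
  refine this.congr fun T => ?_
  rw [expAvg_eq, pathExp_pathCost hP hρ, Finset.sum_sub_distrib]
  simp only [Function.comp_apply]
  ring

/-- Every feasible point of the linear program is the limiting occupation measure of some policy. -/
lemma IsLPFeasible.exists_policy [NeZero Q] (hP : P ∈ Matrix.rowStochastic ℝ (Fin Q))
    (hirr : P.IsIrreducible) (hX : 1 ≤ X) {ω : Fin Q → ℝ} {E : ℝ} {μ y : Fin X → Fin Q → ℝ}
    (h : IsLPFeasible P ω E X μ y) :
    ∃ π : Policy Q, ∀ ρ ∈ stdSimplex ℝ (Fin Q), ∀ c : ℕ → Fin Q → Bool → ℝ,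
      Tendsto (expAvg P ρ π c) atTop (𝓝 (∑ i : Fin X, ∑ q,
        (y i q * c (i + 1) q true + (μ i q - y i q) * c (i + 1) q false))) := by
  obtain ⟨p, hp, hp1, hpP⟩ := exists_pos_stationary hP hirr
  -- Threshold `1` is the policy that always schedules. It may break the budget, which does not
  -- matter because its share `ε n` tends to `0`.
  have h₀ := isLPFeasible_threshold (ω := ω) hp hp1 hpP le_rfl hX
  let ε : ℕ → ℝ := fun n => 1 / ((n : ℝ) + 1)
  have hε0 : ∀ n, 0 < ε n := fun n => by positivity
  have hε1 : ∀ n, ε n ≤ 1 := fun n => by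
    simp only [ε]
    rw [div_le_one (by positivity)]
    linarith [Nat.cast_nonneg (α := ℝ) n]
  have hε : Tendsto ε atTop (𝓝 0) := tendsto_one_div_add_atTop_nhds_zero_nat
  have hmix : ∀ a b : ℝ, Tendsto (fun n => (1 - ε n) * a + ε n * b) atTop (𝓝 a) := fun a b => by
    simpa using ((hε.const_sub 1).mul_const a).add (hε.mul_const b)
  choose ξ hξ hs hocc using fun n => (h.mix h₀ (hε0 n).le (hε1 n)).exists_sched hP
  have hpos : ∀ n q, 0 < (ξ n 1 q : ℝ) := fun n q => by
    have h1 := congrFun (congrFun (hocc n) ⟨0, hX⟩) q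
    have h2 := add_pos_of_nonneg_of_pos
      (mul_nonneg (sub_nonneg.2 (hε1 n)) (h.y_mem ⟨0, hX⟩ q).1) (mul_pos (hε0 n) (hp q))
    simp only [zero_add, if_true, Nat.cast_one, div_one] at h1
    rw [h1] at h2
    exact lt_of_le_of_ne (ξ n 1 q).2.1 fun h0 => by simp [schedOcc, ← h0] at h2
  obtain ⟨k, hk⟩ := exists_tendsto_expAvg hP hX hξ hs
    (fun n w => eq_zero_of_sched_pos hP hirr (hξ n) (hpos n))
    (fun i q => hmix (μ i q) _)
    (fun i q => by
      simp only [← hocc]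
      exact hmix (y i q) _)
  exact ⟨_, hk⟩

end Ergodic

end AoI

namespace AoI

/-! ### Choice of the truncation level and the main theorem. -/

section Equivalence

variable {Q : ℕ} {P : Matrix (Fin Q) (Fin Q) ℝ} {ρ : Fin Q → ℝ} {X : ℕ}
  {ω : Fin Q → ℝ} {W E : ℝ}

lemma longRunAvg_eq_of_tendsto {π : Policy Q} {c : ℕ → Fin Q → Bool → ℝ} {a : ℝ}
    (h : Tendsto (expAvg P ρ π c) atTop (𝓝 a)) : longRunAvg P ρ π c = (a : EReal) :=
  ((continuous_coe_real_ereal.tendsto a).comp h).limsup_eq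

lemma sum_indState (μ y : Fin X → Fin Q → ℝ) (j : Fin X) (r : Fin Q) :
    ∑ i : Fin X, ∑ q, (y i q * indState (j + 1) r (i + 1) q true +
      (μ i q - y i q) * indState (j + 1) r (i + 1) q false) = μ j r := by
  rw [Finset.sum_eq_single j, Finset.sum_eq_single r]
  · simp [indState]
  · intro q _ hq
    simp [indState, hq]
  · simp
  · intro i _ hi
    have : ¬ (i : ℕ) = j := fun h => hi (Fin.ext h)
    simp [indState, this]
  · simp

lemma sum_indSched (μ y : Fin X → Fin Q → ℝ) (j : Fin X) (r : Fin Q) :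
    ∑ i : Fin X, ∑ q, (y i q * indSched (j + 1) r (i + 1) q true +
      (μ i q - y i q) * indSched (j + 1) r (i + 1) q false) = y j r := by
  rw [Finset.sum_eq_single j, Finset.sum_eq_single r]
  · simp [indSched]
  · intro q _ hq
    simp [indSched, hq]
  · simp
  · intro i _ hi
    have : ¬ (i : ℕ) = j := fun h => hi (Fin.ext h)
    simp [indSched, this]
  · simp

lemma sum_costX (μ y : Fin X → Fin Q → ℝ) :
    ∑ i : Fin X, ∑ q, (y i q * costX W (i + 1) q true + (μ i q - y i q) * costX W (i + 1) q false) =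
      lpObjective W μ y := by
  refine Finset.sum_congr rfl fun i _ => Finset.sum_congr rfl fun q _ => ?_
  simp [costX]
  ring

lemma sum_costQ (μ y : Fin X → Fin Q → ℝ) :
    ∑ i : Fin X, ∑ q, (y i q * costQ ω (i + 1) q true + (μ i q - y i q) * costQ ω (i + 1) q false) =
      ∑ i : Fin X, ∑ q, y i q * ω q := by
  simp [costQ]

/-- The truncation level above which no relaxation of the linear program pays off. -/
lemma exists_truncation_level [NeZero Q] (hP : P ∈ Matrix.rowStochastic ℝ (Fin Q))
    (hirr : P.IsIrreducible) (hω : ∀ q, 0 ≤ ω q) (hW : 0 ≤ W) (hE : 0 < E) :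
    ∃ X₀ : ℕ, 1 ≤ X₀ ∧ ∀ X, X₀ ≤ X →
      (∃ μ y : Fin X → Fin Q → ℝ, IsLPFeasible P ω E X μ y) ∧
      ∀ R, 0 < R → ∀ μ y : Fin X → Fin Q → ℝ, IsLPFeasible P ω (E + (∑ q, ω q) * R) X μ y →
        ∃ μ' y' : Fin X → Fin Q → ℝ, IsLPFeasible P ω E X μ' y' ∧
          lpObjective W μ' y' < lpObjective W μ y + (X - W) * R := by
  obtain ⟨p, hp, hp1, hpP⟩ := exists_pos_stationary hP hirr
  have hpow : 0 ≤ ∑ q, p q * ω q := Finset.sum_nonneg fun q _ => mul_nonneg (hp q).le (hω q)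
  -- Transmitting exactly at age `N + 1` uses average power at most `E / 2`; its objective is at
  -- most `W + (N + 1)` for every `X`, so `K` can be fixed independently of `X`.
  obtain ⟨N, hN⟩ := exists_nat_ge (2 * (∑ q, p q * ω q) / E)
  obtain ⟨K, hK⟩ := exists_nat_gt (W + 2 * (∑ q, ω q) * (W + (N + 1 : ℕ)) / E)
  have hslater : (∑ q, p q * ω q) / (N + 1 : ℕ) ≤ E / 2 := by
    rw [div_le_iff₀ (by positivity)]
    rw [div_le_iff₀ hE] at hN
    push_cast
    nlinarith
  refine ⟨max (N + 1) K, by omega, fun X hX => ?_⟩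
  have hNX : N + 1 ≤ X := (le_max_left _ _).trans hX
  have hKX : (K : ℝ) ≤ X := by exact_mod_cast (le_max_right _ _).trans hX
  have h₀ := (isLPFeasible_threshold (ω := ω) hp hp1 hpP (Nat.le_add_left 1 N) hNX).mono hslater
  exact ⟨⟨_, _, h₀.mono (by linarith)⟩, fun R hR μ y h =>
    exists_lt_of_relaxed hω hW hE hR h h₀
      (lpObjective_threshold_le hp hp1 hpP hW (Nat.le_add_left 1 N) hNX) (hK.trans_le hKX)⟩

end Equivalence

end AoI

theorem theorem1 {Q : ℕ} [NeZero Q] (P : Matrix (Fin Q) (Fin Q) ℝ)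
    (hP : P ∈ Matrix.rowStochastic ℝ (Fin Q)) (hirr : P.IsIrreducible)
    (ω : Fin Q → ℝ) (hω : ∀ q, 0 ≤ ω q) (W E : ℝ) (hW : 0 ≤ W) (hE : 0 < E) :
    -- the LP variables are exactly the pairs `(μ, μ ξ)`, `μ` a steady state of a truncated `ξ`
    (∀ (X : ℕ) (μ y : Fin X → Fin Q → ℝ),
      AoI.IsLPFeasible P ω E X μ y ↔
        ∃ ξ : ℕ → Fin Q → unitInterval, AoI.IsTruncated X ξ ∧ AoI.IsSteadyState P ξ X μ ∧
          y = AoI.schedOcc μ ξ ∧ ∑ i : Fin X, ∑ q : Fin Q, μ i q * (ξ (i + 1) q : ℝ) * ω q ≤ E) ∧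
    -- for every large enough truncation level the LP and the CMDP are equivalent
    ∃ X₀ : ℕ, ∀ X : ℕ, X₀ ≤ X →
      (∃ μ y : Fin X → Fin Q → ℝ, AoI.IsLPOptimal P ω W E X μ y) ∧
      ∀ ρ ∈ stdSimplex ℝ (Fin Q),
        -- equal optimal values
        (∀ μ y : Fin X → Fin Q → ℝ, AoI.IsLPOptimal P ω W E X μ y →
          AoI.cmdpValue P ω W E ρ = ((AoI.lpObjective W μ y : ℝ) : EReal)) ∧
        -- every solution of the LP is realized by an optimal policy
        (∀ μ y : Fin X → Fin Q → ℝ, AoI.IsLPOptimal P ω W E X μ y →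
          ∃ π : AoI.Policy Q, AoI.IsOptimal P ω W E ρ π ∧ AoI.HasFrequencies P ρ π μ y ∧
            Tendsto (AoI.expAvg P ρ π (AoI.costX W)) atTop (𝓝 (AoI.lpObjective W μ y)) ∧
            Tendsto (AoI.expAvg P ρ π (AoI.costQ ω)) atTop
              (𝓝 (∑ i : Fin X, ∑ q : Fin Q, y i q * ω q))) ∧
        -- the occupation frequencies of every optimal policy solve the LP
        (∀ (π : AoI.Policy Q) (μ y : Fin X → Fin Q → ℝ), AoI.IsOptimal P ω W E ρ π →
          AoI.HasFrequencies P ρ π μ y → AoI.IsLPOptimal P ω W E X μ y) ∧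
        -- stationary policies: optimal exactly if `(μ, μ ξ)` solves the LP
        (∀ (ξ : ℕ → Fin Q → unitInterval) (μ : Fin X → Fin Q → ℝ), AoI.IsTruncated X ξ →
          AoI.IsSteadyState P ξ X μ → (∀ μ', AoI.IsSteadyState P ξ X μ' → μ' = μ) →
          (AoI.IsOptimal P ω W E ρ (AoI.stationary ξ) ↔
            AoI.IsLPOptimal P ω W E X μ (AoI.schedOcc μ ξ))) := by
  refine ⟨fun X μ y => AoI.isLPFeasible_iff_exists_sched hP μ y, ?_⟩
  obtain ⟨X₀, hX₀, hlevel⟩ := AoI.exists_truncation_level hP hirr hω hW hE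
  refine ⟨X₀, fun X hX => ?_⟩
  obtain ⟨⟨μ₀, y₀, h₀⟩, hrelax⟩ := hlevel X hX
  have hX1 : 1 ≤ X := hX₀.trans hX
  obtain ⟨μs, ys, hopt⟩ := AoI.exists_isLPOptimal (W := W) h₀
  refine ⟨⟨μs, ys, hopt⟩, fun ρ hρ => ?_⟩
  have hlower : ∀ π, AoI.IsFeasible P ω E ρ π →
      ((AoI.lpObjective W μs ys : ℝ) : EReal) ≤ AoI.longRunAvg P ρ π (AoI.costX W) := by
    intro π hπ
    obtain ⟨φ, μ', y', R, -, hR, hfeas, hle, -⟩ := AoI.exists_folded_limit hP hρ hX1 hω hW hπ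
    refine le_trans (EReal.coe_le_coe_iff.2 ?_) hle
    rcases hR.eq_or_lt with rfl | hR
    · simpa using hopt.2 _ _ (hfeas.mono (by simp))
    · obtain ⟨μ₁, y₁, h₁, hlt⟩ := hrelax R hR _ _ hfeas
      exact (hopt.2 _ _ h₁).trans hlt.le
  have hobj : ∀ μ y : Fin X → Fin Q → ℝ, AoI.IsLPOptimal P ω W E X μ y →
      AoI.lpObjective W μ y = AoI.lpObjective W μs ys := fun μ y h =>
    le_antisymm (h.2 _ _ hopt.1) (hopt.2 _ _ h.1)
  have hrealize : ∀ μ y : Fin X → Fin Q → ℝ, AoI.IsLPOptimal P ω W E X μ y →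
      ∃ π : AoI.Policy Q, AoI.IsOptimal P ω W E ρ π ∧ AoI.HasFrequencies P ρ π μ y ∧
        Tendsto (AoI.expAvg P ρ π (AoI.costX W)) atTop (𝓝 (AoI.lpObjective W μ y)) ∧
        Tendsto (AoI.expAvg P ρ π (AoI.costQ ω)) atTop
          (𝓝 (∑ i : Fin X, ∑ q : Fin Q, y i q * ω q)) := by
    intro μ y h
    obtain ⟨π, hπ⟩ := h.1.exists_policy hP hirr hX1
    have hcX := hπ ρ hρ (AoI.costX W)
    have hcQ := hπ ρ hρ (AoI.costQ ω)
    rw [AoI.sum_costX] at hcX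
    rw [AoI.sum_costQ] at hcQ
    refine ⟨π, ⟨?_, fun π' hπ' => ?_⟩, fun i q => ⟨?_, ?_⟩, hcX, hcQ⟩
    · rw [AoI.IsFeasible, AoI.longRunAvg_eq_of_tendsto hcQ, EReal.coe_le_coe_iff]
      exact h.1.power
    · rw [AoI.longRunAvg_eq_of_tendsto hcX, hobj μ y h]
      exact hlower π' hπ'
    · simpa only [AoI.sum_indState] using hπ ρ hρ (AoI.indState (i + 1) q)
    · simpa only [AoI.sum_indSched] using hπ ρ hρ (AoI.indSched (i + 1) q)
  obtain ⟨πs, hπs, -, hcost, -⟩ := hrealize μs ys hopt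
  have hvalue : ∀ π, AoI.IsOptimal P ω W E ρ π → AoI.longRunAvg P ρ π (AoI.costX W) =
      ((AoI.lpObjective W μs ys : ℝ) : EReal) := by
    intro π hπ
    refine le_antisymm ?_ (hlower π hπ.1)
    rw [← AoI.longRunAvg_eq_of_tendsto hcost]
    exact hπ.2 πs hπs.1
  refine ⟨fun μ y h => ?_, hrealize, fun π μ y hπ hfreq => ?_, fun ξ μ hξ hμ huniq => ?_⟩
  · rw [hobj μ y h]
    refine le_antisymm ?_ (le_iInf₂ hlower)
    rw [← hvalue πs hπs]
    exact iInf₂_le πs hπs.1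
  · obtain ⟨φ, μ', y', R, hφ, hR, hfeas, hle, hlim⟩ :=
      AoI.exists_folded_limit hP hρ hX1 hω hW hπ.1
    rw [hvalue π hπ, EReal.coe_le_coe_iff] at hle
    rcases hR.eq_or_lt with rfl | hR
    · obtain rfl : μ' = μ := by
        funext i q
        exact tendsto_nhds_unique (hlim rfl i q).1 ((hfreq i q).1.comp hφ.tendsto_atTop)
      obtain rfl : y' = y := by
        funext i q
        exact tendsto_nhds_unique (hlim rfl i q).2 ((hfreq i q).2.comp hφ.tendsto_atTop)
      refine ⟨hfeas.mono (by simp), fun μ₁ y₁ h₁ => le_trans ?_ (hopt.2 μ₁ y₁ h₁)⟩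
      simpa using hle
    -- A positive frequency of ages above `X` would produce a feasible point strictly below the
    -- optimal value.
    · obtain ⟨μ₁, y₁, h₁, hlt⟩ := hrelax R hR _ _ hfeas
      exact absurd (hopt.2 _ _ h₁) (not_le.2 (hlt.trans_le hle))
  · have hz : ∀ w : Fin X × Fin Q → ℝ, Matrix.vecMul w (AoI.stateMatrix P ξ X) = w →
        ∑ a, w a = 0 → w = 0 := fun w hw hsum =>
      AoI.eq_zero_of_unique_stationary (AoI.stateMatrix_mem_rowStochastic hP hξ)
        (μ := Function.uncurry μ) (fun ν hν hνK => by
          rw [← huniq (Function.curry ν) ⟨by simpa using hν, by simpa using hνK⟩,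
            Function.uncurry_curry]) hw hsum
    -- For a constant sequence of scheduling probabilities the switching policy is `stationary ξ`,
    -- whatever `k` is.
    obtain ⟨k, hk⟩ := AoI.exists_tendsto_expAvg hP hX1 (fun _ : ℕ => hξ) (fun _ => hμ)
      (fun _ => hz) (fun _ _ => tendsto_const_nhds) (fun _ _ => tendsto_const_nhds)
    have hcX : Tendsto (AoI.expAvg P ρ (AoI.stationary ξ) (AoI.costX W)) atTop
        (𝓝 (AoI.lpObjective W μ (AoI.schedOcc μ ξ))) := by
      rw [← AoI.sum_costX]
      exact hk ρ hρ _
    have hcQ : Tendsto (AoI.expAvg P ρ (AoI.stationary ξ) (AoI.costQ ω)) atTop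
        (𝓝 (∑ i : Fin X, ∑ q : Fin Q, AoI.schedOcc μ ξ i q * ω q)) := by
      rw [← AoI.sum_costQ μ]
      exact hk ρ hρ _
    constructor
    · intro h
      have hpow := h.1
      rw [AoI.IsFeasible, AoI.longRunAvg_eq_of_tendsto hcQ, EReal.coe_le_coe_iff] at hpow
      have hval := hvalue _ h
      rw [AoI.longRunAvg_eq_of_tendsto hcX, EReal.coe_eq_coe_iff] at hval
      exact ⟨hμ.isLPFeasible hpow, fun μ₁ y₁ h₁ => hval.le.trans (hopt.2 _ _ h₁)⟩
    · intro h
      refine ⟨?_, fun π' hπ' => ?_⟩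
      · rw [AoI.IsFeasible, AoI.longRunAvg_eq_of_tendsto hcQ, EReal.coe_le_coe_iff]
        exact h.1.power
      · rw [AoI.longRunAvg_eq_of_tendsto hcX, hobj _ _ h]
        exact hlower π' hπ'
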